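/- Let $K$ be a field of characteristic different from $2$ and let $\operatorname{GW}(K)$ be its Grothendieck--Witt ring, the group completion of the semiring (under direct sum and tensor product) of isometry classes of nondegenerate symmetric bilinear forms on finite-dimensional $K$-vector spaces. For a morphism of $K$-varieties $f=(f_1,\dots,f_n)\colon\mathbb{A}^n\to\mathbb{A}^n$ sending the origin to itself, such that the origin is isolated in its fiber $f^{-1}(0)$, let $Q(f)=K[x_1,\dots,x_n]_{(x_1,\dots,x_n)}/(f_1,\dots,f_n)$ be the local algebra at the origin, and let $E(f)\in Q(f)$ be the distinguished socle element, i.e. the class of $\det(a_{ij})$, where $a_{ij}\in K[x_1,\dots,x_n]$ are polynomials with $f_i=\sum_j a_{ij}x_j$. The EKL-degree $\deg_0^{\operatorname{EKL}}f\in\operatorname{GW}(K)$ is the class of the bilinear form $\beta_\phi(a,b)=\phi(ab)$ on $Q(f)$, where $\phi\colon Q(f)\to K$ is any $K$-linear functional with $\phi(E(f))=1$. **Theorem.** Let $f,g\colon\mathbb{A}^n\to\mathbb{A}^n$ be morphisms of $K$-varieties sending the origin to itself, such that the origin is isolated in $f^{-1}(0)$ and in $g^{-1}(0)$. Then $f\circ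 g$ sends the origin to itself, the origin is isolated in $(f\circ g)^{-1}(0)$, the EKL-degrees of $f$, $g$ and $f\circ g$ are well defined (functionals $\phi$ as above exist, and the forms $\beta_\phi$ are nondegenerate on finite-dimensional spaces, with a class in $\operatorname{GW}(K)$ that depends neither on $\phi$ nor on the $a_{ij}$), and $$\deg_0^{\operatorname{EKL}}(f\circ g)=\deg_0^{\operatorname{EKL}}(f)\cdot\deg_0^{\operatorname{EKL}}(g)\quad\text{in }\operatorname{GW}(K).$$ -/

import Mathlib

open scoped TensorProduct

noncomputable section

universe u

/-! ### The Grothendieck-Witt ring -/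

/-- A nondegenerate symmetric bilinear form on a finite-dimensional `K`-vector space. -/
structure SymmBilinSpace (K : Type u) [Field K] where
  /-- The underlying vector space. -/
  V : Type u
  [addCommGroup : AddCommGroup V]
  [module : Module K V]
  [finite : Module.Finite K V]
  /-- The bilinear form. -/
  form : LinearMap.BilinForm K V
  symm : form.IsSymm
  nondegenerate : form.Nondegenerate

namespace SymmBilinSpace

attribute [instance] SymmBilinSpace.addCommGroup SymmBilinSpace.module SymmBilinSpace.finite

variable {K : Type u} [Field K]

/-- For a symmetric form it suffices to check nondegeneracy on one side. -/
theorem nondegenerate_of_left {V : Type u} [AddCommGroup V] [Module K V]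
    {B : LinearMap.BilinForm K V} (hs : B.IsSymm)
    (h : ∀ x, (∀ y, B x y = 0) → x = 0) : B.Nondegenerate :=
  ⟨h, fun y hy => h y fun x => (hs.eq y x).trans (hy x)⟩

/-- Isometry of bilinear spaces. -/
instance setoid (K : Type u) [Field K] : Setoid (SymmBilinSpace K) where
  r A B := A.form.Equivalent B.form
  iseqv := ⟨fun A => .refl A.form, fun h => h.symm, fun h h' => h.trans h'⟩

/-- A linear equivalence compatible with the forms gives an isometry. -/
theorem equiv_of {A B : SymmBilinSpace K} (e : A.V ≃ₗ[K] B.V)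
    (h : ∀ x y, B.form (e x) (e y) = A.form x y) : A ≈ B :=
  ⟨{ e with map_app' := h }⟩

/-- The orthogonal direct sum: `((x, y), (x', y')) ↦ A(x, x') + B(y, y')`. -/
abbrev sum (A B : SymmBilinSpace K) : SymmBilinSpace K where
  V := A.V × B.V
  form := A.form.comp (LinearMap.fst K A.V B.V) (LinearMap.fst K A.V B.V) +
    B.form.comp (LinearMap.snd K A.V B.V) (LinearMap.snd K A.V B.V)
  symm := ⟨fun x y => by simp [A.symm.eq x.1, B.symm.eq x.2]⟩
  nondegenerate := nondegenerate_of_left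
    ⟨fun x y => by simp [A.symm.eq x.1, B.symm.eq x.2]⟩ fun x hx => by
      refine Prod.ext (A.nondegenerate.1 _ fun y => ?_) (B.nondegenerate.1 _ fun y => ?_)
      · simpa using hx (y, 0)
      · simpa using hx (0, y)

theorem sum_form_apply (A B : SymmBilinSpace K) (x y : A.V × B.V) :
    (sum A B).form x y = A.form x.1 y.1 + B.form x.2 y.2 := rfl

/-- The zero space. -/
abbrev zero (K : Type u) [Field K] : SymmBilinSpace K where
  V := PUnit
  form := 0
  symm := ⟨fun _ _ => rfl⟩
  nondegenerate := ⟨fun _ _ => rfl, fun _ _ => rfl⟩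

/-- The form `(x, y) ↦ x * y` on `K`. -/
abbrev one (K : Type u) [Field K] : SymmBilinSpace K where
  V := K
  form := LinearMap.mul K K
  symm := ⟨fun x y => mul_comm x y⟩
  nondegenerate := nondegenerate_of_left ⟨fun x y => mul_comm x y⟩ fun x hx => by
    simpa using hx 1

theorem one_form_apply (x y : K) : (one K).form x y = x * y := rfl

theorem tmul_left {V W : Type u} [AddCommGroup V] [Module K V] [Module.Finite K V]
    [AddCommGroup W] [Module K W] [Module.Finite K W]
    {B : LinearMap.BilinForm K V} {C : LinearMap.BilinForm K W}
    (hB : B.Nondegenerate) (hC : C.Nondegenerate) (x : V ⊗[K] W)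
    (hx : ∀ y, LinearMap.BilinForm.tmul B C x y = 0) : x = 0 := by
  let e : V ⊗[K] W ≃ₗ[K] Module.Dual K (V ⊗[K] W) :=
    (TensorProduct.congr (B.toDual hB) (C.toDual hC)).trans
      (TensorProduct.dualDistribEquiv K V W)
  have he : (e : V ⊗[K] W →ₗ[K] Module.Dual K (V ⊗[K] W)) =
      LinearMap.BilinForm.tmul B C := by
    ext v w v' w'
    simp [e, TensorProduct.dualDistribEquiv, TensorProduct.dualDistribEquivOfBasis,
      LinearMap.BilinForm.toDual_def, mul_comm]
  have : e x = 0 := by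
    ext1
    rw [← LinearEquiv.coe_coe, he]
    ext
    simp [hx]
  simpa using this

/-- The tensor product: `(v ⊗ w, v' ⊗ w') ↦ A(v, v') * B(w, w')`. -/
abbrev tensor (A B : SymmBilinSpace K) : SymmBilinSpace K where
  V := A.V ⊗[K] B.V
  form := LinearMap.BilinForm.tmul A.form B.form
  symm := LinearMap.BilinForm.isSymm_iff.mpr <|
    (LinearMap.BilinForm.isSymm_iff.mp A.symm).tmul (LinearMap.BilinForm.isSymm_iff.mp B.symm)
  nondegenerate := nondegenerate_of_left
    (LinearMap.BilinForm.isSymm_iff.mpr <|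
      (LinearMap.BilinForm.isSymm_iff.mp A.symm).tmul (LinearMap.BilinForm.isSymm_iff.mp B.symm))
    (tmul_left A.nondegenerate B.nondegenerate)

theorem tensor_form_tmul (A B : SymmBilinSpace K) (v v' : A.V) (w w' : B.V) :
    (tensor A B).form (v ⊗ₜ w) (v' ⊗ₜ w') = A.form v v' * B.form w w' :=
  mul_comm _ _

/-- To compare with the form of a tensor product, pure tensors suffice. -/
theorem tmul_ext {V W : Type u} [AddCommGroup V] [Module K V] [AddCommGroup W] [Module K W]
    {F G : LinearMap.BilinForm K (V ⊗[K] W)}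
    (h : ∀ v w v' w', F (v ⊗ₜ w) (v' ⊗ₜ w') = G (v ⊗ₜ w) (v' ⊗ₜ w')) (x y : V ⊗[K] W) :
    F x y = G x y := by
  have : F = G := by
    ext v w v' w'
    exact h v w v' w'
  rw [this]

/-- A linear equivalence compatible with the forms on pure tensors is an isometry. -/
theorem tensor_equiv_of {A B C : SymmBilinSpace K} (e : A.V ⊗[K] B.V ≃ₗ[K] C.V)
    (h : ∀ v w v' w', C.form (e (v ⊗ₜ w)) (e (v' ⊗ₜ w')) = A.form v v' * B.form w w') :
    tensor A B ≈ C :=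
  equiv_of (A := tensor A B) e fun x y =>
    tmul_ext (F := C.form.comp e.toLinearMap e.toLinearMap) (G := (tensor A B).form)
      (fun v w v' w' => (h v w v' w').trans (tensor_form_tmul A B v v' w w').symm) x y

theorem sum_congr {A A' B B' : SymmBilinSpace K} (hA : A ≈ A') (hB : B ≈ B') :
    sum A B ≈ sum A' B' := by
  obtain ⟨a⟩ := hA
  obtain ⟨b⟩ := hB
  refine equiv_of (A := sum A B) (B := sum A' B')
    (LinearEquiv.prodCongr a.toLinearEquiv b.toLinearEquiv) fun x y => ?_
  exact congr_arg₂ (· + ·) (a.map_app' x.1 y.1) (b.map_app' x.2 y.2)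

theorem tensor_congr {A A' B B' : SymmBilinSpace K} (hA : A ≈ A') (hB : B ≈ B') :
    tensor A B ≈ tensor A' B' := by
  obtain ⟨a⟩ := hA
  obtain ⟨b⟩ := hB
  refine tensor_equiv_of (C := tensor A' B')
    (TensorProduct.congr a.toLinearEquiv b.toLinearEquiv) fun v w v' w' => ?_
  rw [TensorProduct.congr_tmul, TensorProduct.congr_tmul, tensor_form_tmul]
  exact congr_arg₂ (· * ·) (a.map_app' v v') (b.map_app' w w')

theorem sum_comm (A B : SymmBilinSpace K) : sum A B ≈ sum B A :=
  equiv_of (A := sum A B) (B := sum B A) (LinearEquiv.prodComm K A.V B.V)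
    fun _ _ => add_comm _ _

theorem sum_assoc (A B C : SymmBilinSpace K) : sum (sum A B) C ≈ sum A (sum B C) :=
  equiv_of (A := sum (sum A B) C) (B := sum A (sum B C)) (LinearEquiv.prodAssoc K A.V B.V C.V)
    fun _ _ => (add_assoc _ _ _).symm

theorem zero_sum (A : SymmBilinSpace K) : sum (zero K) A ≈ A :=
  equiv_of (A := sum (zero K) A) (LinearEquiv.uniqueProd (R := K) (M := A.V) (M₂ := PUnit.{u + 1}))
    fun _ _ => (zero_add _).symm

theorem tensor_comm (A B : SymmBilinSpace K) : tensor A B ≈ tensor B A :=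
  tensor_equiv_of (C := tensor B A) (TensorProduct.comm K A.V B.V) fun v w v' w' => by
    rw [TensorProduct.comm_tmul, TensorProduct.comm_tmul, tensor_form_tmul, mul_comm]

theorem one_tensor (A : SymmBilinSpace K) : tensor (one K) A ≈ A :=
  tensor_equiv_of (A := one K) (TensorProduct.lid K A.V) fun v w v' w' => by
    rw [TensorProduct.lid_tmul, TensorProduct.lid_tmul, one_form_apply]
    simp [mul_assoc, mul_left_comm]

theorem zero_tensor (A : SymmBilinSpace K) : tensor (zero K) A ≈ zero K :=
  have : Subsingleton (PUnit.{u + 1} ⊗[K] A.V) := inferInstance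
  tensor_equiv_of (A := zero K) (C := zero K)
    (0 : PUnit.{u + 1} ⊗[K] A.V ≃ₗ[K] PUnit.{u + 1}) fun _ _ _ _ =>
      (zero_mul _).symm

theorem sum_tensor (A B C : SymmBilinSpace K) :
    tensor (sum A B) C ≈ sum (tensor A C) (tensor B C) :=
  tensor_equiv_of (A := sum A B) (C := sum (tensor A C) (tensor B C))
    (TensorProduct.prodLeft K K A.V B.V C.V) fun v w v' w' => by
      obtain ⟨a, b⟩ := v
      obtain ⟨a', b'⟩ := v'
      rw [TensorProduct.prodLeft_tmul, TensorProduct.prodLeft_tmul, sum_form_apply,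
        sum_form_apply, tensor_form_tmul, tensor_form_tmul, add_mul]

theorem tmul_ext₃ {U V W : Type u} [AddCommGroup U] [Module K U] [AddCommGroup V] [Module K V]
    [AddCommGroup W] [Module K W] {F G : LinearMap.BilinForm K ((U ⊗[K] V) ⊗[K] W)}
    (h : ∀ x v w x' v' w', F (x ⊗ₜ v ⊗ₜ w) (x' ⊗ₜ v' ⊗ₜ w') = G (x ⊗ₜ v ⊗ₜ w) (x' ⊗ₜ v' ⊗ₜ w'))
    (x y : (U ⊗[K] V) ⊗[K] W) : F x y = G x y := by
  have : F = G := by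
    ext x v w x' v' w'
    exact h x v w x' v' w'
  rw [this]

theorem tensor_assoc (A B C : SymmBilinSpace K) :
    tensor (tensor A B) C ≈ tensor A (tensor B C) :=
  equiv_of (A := tensor (tensor A B) C) (B := tensor A (tensor B C))
    (TensorProduct.assoc K A.V B.V C.V) fun x y =>
    tmul_ext₃ (F := (tensor A (tensor B C)).form.comp
        (TensorProduct.assoc K A.V B.V C.V).toLinearMap
        (TensorProduct.assoc K A.V B.V C.V).toLinearMap)
      (G := (tensor (tensor A B) C).form) (fun _ _ _ _ _ _ => mul_assoc _ _ _) x y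

end SymmBilinSpace

/-- Isometry classes of nondegenerate symmetric bilinear forms. -/
def BilinIsomClass (K : Type u) [Field K] : Type (u + 1) :=
  Quotient (SymmBilinSpace.setoid K)

namespace BilinIsomClass

open SymmBilinSpace

variable {K : Type u} [Field K]

/-- The isometry class of a form. -/
def mk (A : SymmBilinSpace K) : BilinIsomClass K := Quotient.mk _ A

instance : Zero (BilinIsomClass K) := ⟨Quotient.mk _ (SymmBilinSpace.zero K)⟩

instance : One (BilinIsomClass K) := ⟨Quotient.mk _ (SymmBilinSpace.one K)⟩

instance : Add (BilinIsomClass K) :=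
  ⟨Quotient.map₂ SymmBilinSpace.sum fun _ _ h _ _ h' => sum_congr h h'⟩

instance : Mul (BilinIsomClass K) :=
  ⟨Quotient.map₂ SymmBilinSpace.tensor fun _ _ h _ _ h' => tensor_congr h h'⟩

/-- Isometry classes form a commutative semiring under direct sum and tensor product. -/
instance : CommSemiring (BilinIsomClass K) where
  nsmul := nsmulRec
  npow := npowRec
  add_assoc := by
    rintro ⟨A⟩ ⟨B⟩ ⟨C⟩
    exact Quotient.sound (sum_assoc A B C)
  zero_add := by
    rintro ⟨A⟩
    exact Quotient.sound (zero_sum A)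
  add_zero := by
    rintro ⟨A⟩
    exact Quotient.sound (Setoid.trans (sum_comm A (SymmBilinSpace.zero K)) (zero_sum A))
  add_comm := by
    rintro ⟨A⟩ ⟨B⟩
    exact Quotient.sound (sum_comm A B)
  left_distrib := by
    rintro ⟨A⟩ ⟨B⟩ ⟨C⟩
    exact Quotient.sound (Setoid.trans (tensor_comm A (sum B C)) (Setoid.trans (sum_tensor B C A)
      (sum_congr (tensor_comm B A) (tensor_comm C A))))
  right_distrib := by
    rintro ⟨A⟩ ⟨B⟩ ⟨C⟩
    exact Quotient.sound (sum_tensor A B C)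
  zero_mul := by
    rintro ⟨A⟩
    exact Quotient.sound (zero_tensor A)
  mul_zero := by
    rintro ⟨A⟩
    exact Quotient.sound (Setoid.trans (tensor_comm A (SymmBilinSpace.zero K)) (zero_tensor A))
  mul_assoc := by
    rintro ⟨A⟩ ⟨B⟩ ⟨C⟩
    exact Quotient.sound (tensor_assoc A B C)
  one_mul := by
    rintro ⟨A⟩
    exact Quotient.sound (one_tensor A)
  mul_one := by
    rintro ⟨A⟩
    exact Quotient.sound (Setoid.trans (tensor_comm A (SymmBilinSpace.one K)) (one_tensor A))
  mul_comm := by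
    rintro ⟨A⟩ ⟨B⟩
    exact Quotient.sound (tensor_comm A B)

end BilinIsomClass

/-! ### The group completion of a commutative semiring is a commutative ring -/

namespace GroupCompletion

open Algebra

variable {S : Type*} [CommSemiring S]

theorem lift_of {G : Type*} [AddCommGroup G] (φ : S →+ G) (s : S) :
    GrothendieckAddGroup.lift φ (GrothendieckAddGroup.of s) = φ s :=
  DFunLike.congr_fun (GrothendieckAddGroup.lift.symm_apply_apply φ) s

/-- The additive extension of `t ↦ s * t` to the group completion. -/
def mulLeftHom (s : S) : GrothendieckAddGroup S →+ GrothendieckAddGroup S :=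
  GrothendieckAddGroup.lift (GrothendieckAddGroup.of.comp (AddMonoidHom.mulLeft s))

theorem mulLeftHom_of (s t : S) :
    mulLeftHom s (GrothendieckAddGroup.of t) = GrothendieckAddGroup.of (s * t) :=
  lift_of _ t

/-- Additive maps on the group completion are determined by their values on `S`. -/
theorem hom_ext {φ ψ : GrothendieckAddGroup S →+ GrothendieckAddGroup S}
    (h : ∀ s : S, φ (GrothendieckAddGroup.of s) = ψ (GrothendieckAddGroup.of s)) : φ = ψ :=
  GrothendieckAddGroup.lift.symm.injective (AddMonoidHom.ext h)

/-- The biadditive extension of the multiplication of `S` to its group completion. -/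
def mulHom (S : Type*) [CommSemiring S] :
    GrothendieckAddGroup S →+ GrothendieckAddGroup S →+ GrothendieckAddGroup S :=
  GrothendieckAddGroup.lift
    { toFun := mulLeftHom
      map_zero' := hom_ext fun t => by
        rw [mulLeftHom_of, zero_mul, map_zero, AddMonoidHom.zero_apply]
      map_add' := fun s s' => hom_ext fun t => by
        rw [AddMonoidHom.add_apply, mulLeftHom_of, mulLeftHom_of, mulLeftHom_of, add_mul,
          map_add] }

theorem mulHom_of (s t : S) : mulHom S (GrothendieckAddGroup.of s) (GrothendieckAddGroup.of t) =
    GrothendieckAddGroup.of (s * t) := by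
  rw [mulHom, lift_of]
  exact mulLeftHom_of s t

/-- Every element of the group completion is a difference of elements of `S`. -/
theorem exists_sub (x : GrothendieckAddGroup S) :
    ∃ s t : S, x = GrothendieckAddGroup.of s - GrothendieckAddGroup.of t := by
  induction x using AddLocalization.ind with
  | H y =>
    refine ⟨y.1, y.2, ?_⟩
    change _ = AddLocalization.addMonoidOf ⊤ y.1 - AddLocalization.addMonoidOf ⊤ (y.2 : S)
    rw [← AddLocalization.mk_zero_eq_addMonoidOf_mk, ← AddLocalization.mk_zero_eq_addMonoidOf_mk,
      GrothendieckAddGroup.mk_sub_mk]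
    simp

/-- The ring structure on the group completion of a commutative semiring: the unique one for
which the canonical map is a homomorphism of semirings. -/
abbrev commRing (S : Type*) [CommSemiring S] : CommRing (GrothendieckAddGroup S) where
  __ := (inferInstance : AddCommGroup (GrothendieckAddGroup S))
  mul x y := mulHom S x y
  one := GrothendieckAddGroup.of 1
  npow := @npowRec _ ⟨GrothendieckAddGroup.of 1⟩ ⟨fun x y => mulHom S x y⟩
  left_distrib x y z := map_add (mulHom S x) y z
  right_distrib x y z := by
    change mulHom S (x + y) z = mulHom S x z + mulHom S y z
    rw [map_add, AddMonoidHom.add_apply]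
  zero_mul x := by
    change mulHom S 0 x = 0
    rw [map_zero, AddMonoidHom.zero_apply]
  mul_zero x := map_zero (mulHom S x)
  one_mul x := by
    change mulHom S (GrothendieckAddGroup.of 1) x = x
    obtain ⟨s, t, rfl⟩ := exists_sub x
    rw [map_sub, mulHom_of, mulHom_of, one_mul, one_mul]
  mul_one x := by
    change mulHom S x (GrothendieckAddGroup.of 1) = x
    obtain ⟨s, t, rfl⟩ := exists_sub x
    rw [map_sub, AddMonoidHom.sub_apply, mulHom_of, mulHom_of, mul_one, mul_one]
  mul_comm x y := by
    change mulHom S x y = mulHom S y x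
    obtain ⟨s, t, rfl⟩ := exists_sub x
    obtain ⟨s', t', rfl⟩ := exists_sub y
    simp only [map_sub, AddMonoidHom.sub_apply, mulHom_of, mul_comm s', mul_comm t']
    abel
  mul_assoc x y z := by
    change mulHom S (mulHom S x y) z = mulHom S x (mulHom S y z)
    obtain ⟨s, t, rfl⟩ := exists_sub x
    obtain ⟨s', t', rfl⟩ := exists_sub y
    obtain ⟨s'', t'', rfl⟩ := exists_sub z
    simp only [map_sub, AddMonoidHom.sub_apply, mulHom_of, mul_assoc]

end GroupCompletion

/-- The Grothendieck-Witt ring of `K`: the group completion of the semiring of isometry classes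
of nondegenerate symmetric bilinear forms on finite-dimensional `K`-vector spaces. -/
def GW (K : Type u) [Field K] : Type (u + 1) :=
  Algebra.GrothendieckAddGroup (BilinIsomClass K)

namespace GW

variable {K : Type u} [Field K]

instance : CommRing (GW K) := GroupCompletion.commRing (BilinIsomClass K)

/-- The class in `GW K` of a nondegenerate symmetric bilinear form. -/
def cls (A : SymmBilinSpace K) : GW K :=
  Algebra.GrothendieckAddGroup.of (BilinIsomClass.mk A)

theorem cls_eq {A B : SymmBilinSpace K} (h : A.form.Equivalent B.form) : cls A = cls B :=
  congrArg (Algebra.GrothendieckAddGroup.of (M := BilinIsomClass K)) (Quotient.sound h)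

theorem cls_tensor (A B : SymmBilinSpace K) : cls (A.tensor B) = cls A * cls B :=
  (GroupCompletion.mulHom_of (BilinIsomClass.mk A) (BilinIsomClass.mk B)).symm

theorem cls_sum (A B : SymmBilinSpace K) : cls (A.sum B) = cls A + cls B :=
  map_add Algebra.GrothendieckAddGroup.of (BilinIsomClass.mk A) (BilinIsomClass.mk B)

theorem cls_one : cls (SymmBilinSpace.one K) = 1 := rfl

end GW

/-! ### Polynomial self-maps of affine space and their degree at the origin -/

/-- A morphism of `K`-varieties from affine `n`-space to itself, given by its components. -/
abbrev PolyMap (K : Type u) [Field K] (n : ℕ) : Type u := Fin n → MvPolynomial (Fin n) K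

namespace PolyMap

open MvPolynomial

variable {K : Type u} [Field K] {n : ℕ}

/-- The composition `f ∘ g`, with components `fᵢ(g₁, …, gₙ)`. -/
def comp (f g : PolyMap K n) : PolyMap K n := fun i => aeval g (f i)

/-- The map sends the origin to itself. -/
def FixesOrigin (f : PolyMap K n) : Prop := ∀ i, eval 0 (f i) = 0

/-- The ideal of the origin. -/
def originIdeal (K : Type u) [Field K] (n : ℕ) : Ideal (MvPolynomial (Fin n) K) :=
  RingHom.ker (eval (0 : Fin n → K))

instance : (originIdeal K n).IsPrime := RingHom.ker_isPrime _

/-- The origin, as a point of the scheme `𝔸ⁿ = Spec K[x₁, …, xₙ]`. -/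
def origin (K : Type u) [Field K] (n : ℕ) : PrimeSpectrum (MvPolynomial (Fin n) K) :=
  ⟨originIdeal K n, inferInstance⟩

/-- The map on the points of the scheme `𝔸ⁿ`, induced by the substitution `xᵢ ↦ fᵢ`. -/
def onPoints (f : PolyMap K n) :
    PrimeSpectrum (MvPolynomial (Fin n) K) → PrimeSpectrum (MvPolynomial (Fin n) K) :=
  PrimeSpectrum.comap (aeval f : MvPolynomial (Fin n) K →ₐ[K] MvPolynomial (Fin n) K).toRingHom

/-- The origin is isolated in the fiber `f⁻¹(0)`: it is an open point of this fiber. -/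
def IsolatedAtOrigin (f : PolyMap K n) : Prop :=
  ∃ U : Set (PrimeSpectrum (MvPolynomial (Fin n) K)),
    IsOpen U ∧ U ∩ f.onPoints ⁻¹' {origin K n} = {origin K n}

/-- The ideal generated by the components of `f` in the local ring of `𝔸ⁿ` at the origin. -/
def localIdeal (f : PolyMap K n) : Ideal (Localization.AtPrime (originIdeal K n)) :=
  Ideal.span (Set.range fun i =>
    algebraMap (MvPolynomial (Fin n) K) (Localization.AtPrime (originIdeal K n)) (f i))

/-- The local algebra `Q(f) = K[x₁, …, xₙ]_{m₀} / (f₁, …, fₙ)`. -/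
abbrev LocalAlgebra (f : PolyMap K n) : Type u :=
  Localization.AtPrime (originIdeal K n) ⧸ f.localIdeal

/-- The image of a polynomial in the local algebra `Q(f)`. -/
def toLocalAlgebra (f : PolyMap K n) (p : MvPolynomial (Fin n) K) : f.LocalAlgebra :=
  Ideal.Quotient.mk f.localIdeal (algebraMap _ (Localization.AtPrime (originIdeal K n)) p)

/-- `e` is the distinguished socle element `E(f)`: the class of `det (aᵢⱼ)` for some polynomials
`aᵢⱼ` such that `fᵢ = ∑ⱼ aᵢⱼ xⱼ`. -/
def IsSocleElement (f : PolyMap K n) (e : f.LocalAlgebra) : Prop :=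
  ∃ a : Matrix (Fin n) (Fin n) (MvPolynomial (Fin n) K),
    (∀ i, f i = ∑ j, a i j * X j) ∧ e = f.toLocalAlgebra a.det

/-- The bilinear form `β_φ(a, b) = φ(a * b)` on `Q(f)`. -/
def bilin (f : PolyMap K n) (φ : f.LocalAlgebra →ₗ[K] K) : LinearMap.BilinForm K f.LocalAlgebra :=
  (LinearMap.mul K f.LocalAlgebra).compr₂ φ

theorem bilin_apply (f : PolyMap K n) (φ : f.LocalAlgebra →ₗ[K] K) (a b : f.LocalAlgebra) :
    f.bilin φ a b = φ (a * b) := rfl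

theorem bilin_symm (f : PolyMap K n) (φ : f.LocalAlgebra →ₗ[K] K) : (f.bilin φ).IsSymm :=
  ⟨fun a b => congrArg φ (mul_comm a b)⟩

/-- The linear functional `φ` sends the distinguished socle element `E(f)` to `1`. -/
def IsNormalized (f : PolyMap K n) (φ : f.LocalAlgebra →ₗ[K] K) : Prop :=
  ∃ e, f.IsSocleElement e ∧ φ e = 1

/-- `d` is the EKL-degree of `f` at the origin: there are functionals `φ` sending `E(f)` to `1`,
and for every one of them `β_φ` is a nondegenerate form on a finite-dimensional space, whose class
in `GW K` is `d`. -/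
def IsEKLDegree (f : PolyMap K n) (d : GW K) : Prop :=
  (∃ φ, f.IsNormalized φ) ∧
    ∀ φ, f.IsNormalized φ → ∃ (_ : Module.Finite K f.LocalAlgebra)
      (h : (f.bilin φ).Nondegenerate),
      GW.cls { V := f.LocalAlgebra, form := f.bilin φ, symm := f.bilin_symm φ,
               nondegenerate := h } = d

open Classical in
/-- The EKL-degree of `f` at the origin (`0` if `f` has none). -/
def eklDegree (f : PolyMap K n) : GW K :=
  if h : ∃ d, f.IsEKLDegree d then h.choose else 0

theorem IsEKLDegree.unique {f : PolyMap K n} {d d' : GW K} (h : f.IsEKLDegree d)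
    (h' : f.IsEKLDegree d') : d = d' := by
  obtain ⟨φ, hφ⟩ := h.1
  obtain ⟨_, _, rfl⟩ := h.2 φ hφ
  obtain ⟨_, _, rfl⟩ := h'.2 φ hφ
  rfl

theorem IsEKLDegree.eq_eklDegree {f : PolyMap K n} {d : GW K} (h : f.IsEKLDegree d) :
    f.eklDegree = d := by
  have h' : ∃ d, f.IsEKLDegree d := ⟨d, h⟩
  rw [eklDegree, dif_pos h']
  exact h'.choose_spec.unique h

end PolyMap

end

/-! Write A = Q(f), B = Q(f∘g), C = Q(g). Substituting g gives γ : A → B, and B modulo γ(𝔪_A)B is C.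
The chain rule for the matrices makes E(f∘g) the product of γ(E(f)) and a lift of E(g). Since 𝔪_A
E(f) = 0, a normalized functional χ on B induces the functional b ↦ χ(γ(E(f)) b) on C, and it is
again normalized.

A K-linear section of B → C gives an A-linear map μ : A ⊗ C → B. The form pulled back from B need
not be the tensor form, but it is the tensor form twisted by an A-linear operator 1 + N. Pairing
with E(f) ⊗ q shows that N is zero modulo 𝔪_A, so N is nilpotent. In characteristic different from 2
a polynomial in N serves as an inverse square root of 1 + N and makes the two forms isometric;
nondegeneracy makes μ injective and nilpotence of 𝔪_A makes it surjective. This is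
`IsSocleGenerator.exists_tensor_isometry`. The same square root shows that the class does not depend
on the functional (`IsSocleGenerator.exists_isometry`).

All of this needs E(f) to be independent of the matrix and to span the socle of Q(f). Adding
x_i^(m+1) to f_i for large m changes neither Q(f) nor E(f), and produces a system with dominant pure
powers. For such a system an explicit global residue functional vanishes on the ideal, pairs
nondegenerately on the quotient, and takes the value 1 on the determinant.
`PolyMap.isSocleGenerator_det` and `PolyMap.toLocalAlgHom_det_unique` follow from these three
properties. -/

section NilpotentPerturbation

/-! ### Forms that differ by a unipotent operator. -/

open Polynomial

/-- Newton iteration for (1 + X)^(-1/2): if the error is t, replacing p by p(1 - t/2) makes it t²(t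
- 3)/4. -/
theorem exists_sq_mul_one_add_X {K : Type*} [Field K] (h2 : (2 : K) ≠ 0) (k : ℕ) :
    ∃ p r : K[X], p ^ 2 * (1 + X) = 1 + X ^ (k + 1) * r := by
  induction k with
  | zero => exact ⟨1, 1, by ring⟩
  | succ k ih =>
    obtain ⟨p, r, h⟩ := ih
    have hc : (2 : K[X]) * C 2⁻¹ = 1 := by
      rw [← C_ofNat, ← C_mul, mul_inv_cancel₀ h2, C_1]
    refine ⟨p * (1 - C 2⁻¹ * (X ^ (k + 1) * r)),
      X ^ k * r ^ 2 * (C 2⁻¹ ^ 2 - 1 + C 2⁻¹ ^ 2 * (X ^ (k + 1) * r)), ?_⟩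
    linear_combination (1 - C 2⁻¹ * (X ^ (k + 1) * r)) ^ 2 * h
      - (X ^ (k + 1) * r + (X ^ (k + 1) * r) ^ 2) * hc

variable {K : Type*} [Field K] {V : Type*} [AddCommGroup V] [Module K V]

theorem LinearMap.BilinForm.apply_aeval_left {B : LinearMap.BilinForm K V} {N : Module.End K V}
    (h : ∀ x y, B (N x) y = B x (N y)) (p : K[X]) (x y : V) :
    B (aeval N p x) y = B x (aeval N p y) := by
  induction p using Polynomial.induction_on' with
  | add p q hp hq => simp [hp, hq]
  | monomial n a =>
    have key : ∀ (n : ℕ) (x y : V), B ((N ^ n) x) y = B x ((N ^ n) y) := by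
      intro n
      induction n with
      | zero => simp
      | succ n ih =>
        intro x y
        rw [pow_succ, Module.End.mul_apply, ih, h, ← Module.End.mul_apply, ← pow_succ', pow_succ]
    simp [aeval_monomial, key]

/-- A symmetric form `β₁ = β₀(·, (1 + N) ·)` with `N` nilpotent is isometric to `β₀`. -/
theorem LinearMap.BilinForm.exists_isometry_of_isNilpotent (h2 : (2 : K) ≠ 0)
    {β₀ β₁ : LinearMap.BilinForm K V} (h₀ : β₀.IsSymm) (h₁ : β₁.IsSymm) {N : Module.End K V}
    (hN : IsNilpotent N) (h : ∀ x y, β₁ x y = β₀ x (y + N y)) :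
    ∃ e : V ≃ₗ[K] V, ∀ x y, β₁ (e x) (e y) = β₀ x y := by
  obtain ⟨k, hk⟩ := hN
  obtain ⟨p, r, hp⟩ := exists_sq_mul_one_add_X h2 k
  -- Symmetry of both forms makes N self-adjoint for β₀, hence so is every polynomial in N. The
  -- isometry is p(N), with p the truncated inverse square root of 1 + X.
  have hadj : ∀ x y, β₀ (N x) y = β₀ x (N y) := fun x y => by
    have e1 : β₀ x (y + N y) = β₀ y (x + N x) := by
      rw [← h, ← h]
      exact h₁.eq x y
    have e2 : β₀ x y = β₀ y x := h₀.eq x y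
    have e3 : β₀ (N x) y = β₀ y (N x) := h₀.eq (N x) y
    rw [map_add, map_add, e2, add_left_cancel_iff] at e1
    rw [e3, e1]
  have hid : aeval N (p * ((1 + X) * p)) = 1 := by
    have : p * ((1 + X) * p) = 1 + X ^ (k + 1) * r := by rw [← hp]; ring
    rw [this, map_add, map_one, map_mul, map_pow, aeval_X, pow_succ, hk, zero_mul, zero_mul,
      add_zero]
  have hid' : aeval N (((1 + X) * p) * p) = 1 := by rw [mul_comm, hid]
  refine ⟨LinearEquiv.ofLinearMap (aeval N p) (aeval N ((1 + X) * p)) ?_ ?_, fun x y => ?_⟩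
  · rw [← Module.End.mul_eq_comp, ← map_mul, hid]; rfl
  · rw [← Module.End.mul_eq_comp, ← map_mul, hid']; rfl
  · rw [LinearEquiv.coe_ofLinearMap, h, apply_aeval_left hadj]
    have : aeval N p y + N (aeval N p y) = aeval N ((1 + X) * p) y := by
      simp
    rw [this, ← Module.End.mul_apply, ← map_mul, hid, Module.End.one_apply]

end NilpotentPerturbation

/-! ### Local algebras whose socle is a line, and their forms. -/

section SocleGenerator

variable {K : Type u} [Field K] {A : Type u} [CommRing A] [Algebra K A]

/-- `A` is a local `K`-algebra with nilpotent maximal ideal `ker ε` and residue field `K`, and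
its socle is the line spanned by `E`. -/
structure IsSocleGenerator (ε : A →ₐ[K] K) (E : A) : Prop where
  nilpotent : ∃ k, RingHom.ker ε ^ k = ⊥
  ne_zero : E ≠ 0
  mul_eq : ∀ a, a * E = ε a • E
  exists_smul : ∀ h, (∀ a, ε a = 0 → a * h = 0) → ∃ c : K, h = c • E

/-- The bilinear form `(a, b) ↦ φ (a * b)`. -/
abbrev mulForm (φ : A →ₗ[K] K) : LinearMap.BilinForm K A := (LinearMap.mul K A).compr₂ φ

theorem mulForm_isSymm (φ : A →ₗ[K] K) : (mulForm φ).IsSymm :=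
  ⟨fun a b => congrArg φ (mul_comm a b)⟩

namespace IsSocleGenerator

variable {ε : A →ₐ[K] K} {E : A}

/-- Induction down the powers of 𝔪 = ker ε: if a kills 𝔪^(i+1) and t ∈ 𝔪^i, then at lies in the
socle, so at = cE, and c = φ(at) = 0. At i = 0 this gives a = 0. -/
theorem eq_zero_of_forall (hE : IsSocleGenerator ε E) {φ : A →ₗ[K] K} (hφ : φ E = 1) {a : A}
    (ha : ∀ b, φ (a * b) = 0) : a = 0 := by
  obtain ⟨k, hk⟩ := hE.nilpotent
  have key : ∀ j ≤ k, ∀ t ∈ RingHom.ker ε ^ (k - j), a * t = 0 := by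
    intro j
    induction j with
    | zero =>
      intro _ t ht
      rw [Nat.sub_zero, hk, Ideal.mem_bot] at ht
      rw [ht, mul_zero]
    | succ j ih =>
      intro hj t ht
      obtain ⟨c, hc⟩ := hE.exists_smul (a * t) fun x hx => by
        have := ih (by omega) (x * t) (by
          rw [show k - j = k - (j + 1) + 1 by omega, pow_succ']
          exact Ideal.mul_mem_mul hx ht)
        rw [← this]; ring
      have h0 := ha t
      rw [hc, map_smul, hφ, smul_eq_mul, mul_one] at h0
      rw [hc, h0, zero_smul]
  simpa using key k le_rfl 1 (by simp)

theorem nondegenerate (hE : IsSocleGenerator ε E) {φ : A →ₗ[K] K} (hφ : φ E = 1) :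
    (mulForm φ).Nondegenerate :=
  SymmBilinSpace.nondegenerate_of_left (mulForm_isSymm φ) fun _ h => hE.eq_zero_of_forall hφ h

/-- By nondegeneracy φ' = φ(u ·) for some u. Evaluating at E gives ε u = 1, so u - 1 is nilpotent
and the unipotent perturbation result applies. -/
theorem exists_isometry (h2 : (2 : K) ≠ 0) [Module.Finite K A] (hE : IsSocleGenerator ε E)
    {φ φ' : A →ₗ[K] K} (hφ : φ E = 1) (hφ' : φ' E = 1) :
    ∃ e : A ≃ₗ[K] A, ∀ x y, φ' (e x * e y) = φ (x * y) := by
  obtain ⟨u, hu⟩ := ((mulForm φ).toDual (hE.nondegenerate hφ)).surjective φ'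
  have hu' : ∀ b, φ' b = φ (u * b) := fun b => by
    rw [← hu]; rfl
  have h1 : ε u = 1 := by
    have := hu' E
    rwa [hE.mul_eq, map_smul, hφ, hφ', smul_eq_mul, mul_one, eq_comm] at this
  have hn : IsNilpotent (u - 1) := by
    obtain ⟨k, hk⟩ := hE.nilpotent
    refine ⟨k, ?_⟩
    rw [← Ideal.mem_bot, ← hk]
    exact Ideal.pow_mem_pow (by rw [RingHom.mem_ker, map_sub, h1, map_one, sub_self]) k
  exact LinearMap.BilinForm.exists_isometry_of_isNilpotent h2 (mulForm_isSymm φ)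
    (mulForm_isSymm φ') (hn.map (Algebra.lmul K A)) fun x y => by
      change φ' (x * y) = φ (x * (y + (u - 1) * y))
      rw [hu']
      congr 1
      ring

end IsSocleGenerator

/-- `C` is the closed fibre of `γ : A → B` over the point `ε`, with projection `π`. -/
structure IsClosedFibre {B C : Type u} [CommRing B] [Algebra K B] [CommRing C] [Algebra K C]
    (ε : A →ₐ[K] K) (γ : A →ₐ[K] B) (π : B →ₐ[K] C) : Prop where
  surjective : Function.Surjective π
  ker_eq : RingHom.ker π = (RingHom.ker ε).map γ

/-! ### Splitting the form along a closed fibre. -/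

section ClosedFibre

variable {B C : Type u} [CommRing B] [Algebra K B] [CommRing C] [Algebra K C]
  {ε : A →ₐ[K] K} {E : A} {γ : A →ₐ[K] B} {π : B →ₐ[K] C}

theorem IsClosedFibre.of_sum (hπ : Function.Surjective π) (h : ∀ a, ε a = 0 → π (γ a) = 0)
    {ι : Type*} [Fintype ι] {x : ι → A} (hx : ∀ i, ε (x i) = 0)
    (hs : ∀ b, π b = 0 → ∃ c : ι → B, b = ∑ i, c i * γ (x i)) : IsClosedFibre ε γ π := by
  refine ⟨hπ, le_antisymm (fun b hb => ?_) (Ideal.map_le_iff_le_comap.mpr h)⟩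
  obtain ⟨c, rfl⟩ := hs b hb
  exact Ideal.sum_mem _ fun i _ => Ideal.mul_mem_left _ _ (Ideal.mem_map_of_mem γ (hx i))

/-- The functional `φB (γ E * ·)` descends to the closed fibre. -/
theorem IsSocleGenerator.exists_fibre_functional (hE : IsSocleGenerator ε E)
    (h : IsClosedFibre ε γ π) (φB : B →ₗ[K] K) :
    ∃ φC : C →ₗ[K] K, ∀ b, φC (π b) = φB (γ E * b) := by
  obtain ⟨s, hs⟩ := π.toLinearMap.exists_rightInverse_of_surjective
    (LinearMap.range_eq_top.mpr h.surjective)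
  -- The kernel of π is generated by γ(ker ε), and ker ε kills E.
  have hker0 : ∀ x, π x = 0 → γ E * x = 0 := by
    intro x hx
    replace hx : x ∈ (RingHom.ker ε).map γ := h.ker_eq ▸ hx
    induction hx using Submodule.span_induction with
    | zero => exact mul_zero _
    | add x y _ _ hx hy => rw [mul_add, hx, hy, add_zero]
    | smul c x _ hx => rw [smul_eq_mul, mul_left_comm, hx, mul_zero]
    | mem x hx =>
      obtain ⟨a, ha, rfl⟩ := hx
      replace ha : ε a = 0 := ha
      rw [← map_mul, mul_comm, hE.mul_eq, ha, zero_smul, map_zero]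
  refine ⟨φB ∘ₗ LinearMap.mulLeft K (γ E) ∘ₗ s, fun b => ?_⟩
  have h := hker0 (s (π b) - b) (by
    rw [map_sub, sub_eq_zero]
    exact LinearMap.congr_fun hs (π b))
  rw [mul_sub, sub_eq_zero] at h
  exact congrArg φB h

/-- If the functional `C → K` induced by `φB (γ E * ·)` defines a nondegenerate form, then the form
of `B` is the tensor product of the forms of the base `A` and of the closed fibre `C`. -/
theorem IsSocleGenerator.exists_tensor_isometry (h2 : (2 : K) ≠ 0) [Module.Finite K A]
    [Module.Finite K C] (hE : IsSocleGenerator ε E) (hF : IsClosedFibre ε γ π)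
    {φA : A →ₗ[K] K} (hφA : φA E = 1) {φB : B →ₗ[K] K} {φC : C →ₗ[K] K}
    (hφC : ∀ b, φC (π b) = φB (γ E * b)) (hC : (mulForm φC).Nondegenerate) :
    ∃ e : A ⊗[K] C ≃ₗ[K] B, ∀ a q a' q',
      φB (e (a ⊗ₜ q) * e (a' ⊗ₜ q')) = φA (a * a') * φC (q * q') := by
  obtain ⟨s, hs⟩ := π.toLinearMap.exists_rightInverse_of_surjective
    (LinearMap.range_eq_top.mpr hF.surjective)
  have hs' : ∀ q, π (s q) = q := fun q => LinearMap.congr_fun hs q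
  -- The section s is only K-linear, so μ respects the A-module structure but not products; hence
  -- β₁, the pullback along μ, need not equal β₀.
  let μ : A ⊗[K] C →ₗ[K] B := TensorProduct.lift ((LinearMap.mul K B).compl₁₂ γ.toLinearMap s)
  have hμ : ∀ a q, μ (a ⊗ₜ q) = γ a * s q := fun a q => rfl
  have hμs : ∀ (a : A) v, μ (a • v) = γ a * μ v := fun a v => by
    induction v with
    | zero => simp
    | add x y hx hy => rw [smul_add, map_add, hx, hy, map_add, mul_add]
    | tmul x q => rw [TensorProduct.smul_tmul', hμ, hμ, smul_eq_mul, map_mul, mul_assoc]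
  let β₀ : LinearMap.BilinForm K (A ⊗[K] C) :=
    LinearMap.BilinForm.tmul (mulForm φA) (mulForm φC)
  have hβ₀ : ∀ a q a' q', β₀ (a ⊗ₜ q) (a' ⊗ₜ q') = φA (a * a') * φC (q * q') :=
    fun a q a' q' => mul_comm _ _
  have hs₀ : β₀.IsSymm := LinearMap.BilinForm.isSymm_iff.mpr <|
    (LinearMap.BilinForm.isSymm_iff.mp (mulForm_isSymm φA)).tmul
      (LinearMap.BilinForm.isSymm_iff.mp (mulForm_isSymm φC))
  have hn₀ : β₀.Nondegenerate := SymmBilinSpace.nondegenerate_of_left hs₀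
    (SymmBilinSpace.tmul_left (hE.nondegenerate hφA) hC)
  let β₁ : LinearMap.BilinForm K (A ⊗[K] C) := (mulForm φB).compl₁₂ μ μ
  have hβ₁ : ∀ x y, β₁ x y = φB (μ x * μ y) := fun x y => rfl
  have hs₁ : β₁.IsSymm := ⟨fun x y => congrArg φB (mul_comm _ _)⟩
  have hβ₀s : ∀ (a : A) x y, β₀ (a • x) y = β₀ x (a • y) := fun a x y => by
    induction x with
    | zero => simp
    | add x x' hx hx' => rw [smul_add, map_add, map_add, LinearMap.add_apply, hx, hx']; rfl
    | tmul b q =>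
      induction y with
      | zero => simp
      | add y y' hy hy' => rw [smul_add, map_add, map_add, hy, hy']
      | tmul b' q' =>
        rw [TensorProduct.smul_tmul', TensorProduct.smul_tmul', hβ₀, hβ₀, smul_eq_mul,
          smul_eq_mul, mul_assoc, mul_left_comm]
  -- T is the operator representing β₁ through β₀. Scalars from A move across both forms, so T is
  -- A-linear.
  let T : Module.End K (A ⊗[K] C) := (β₀.toDual hn₀).symm.toLinearMap ∘ₗ β₁
  have hT : ∀ x y, β₀ x (T y) = β₁ x y := fun x y => by
    rw [← hs₀.eq, ← hs₁.eq]
    exact LinearMap.BilinForm.apply_toDual_symm_apply (hB := hn₀) (β₁ y) x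
  have hTs : ∀ (a : A) y, T (a • y) = a • T y := fun a y => by
    rw [← sub_eq_zero]
    refine hn₀.2 _ fun x => ?_
    rw [map_sub, hT, ← hβ₀s, hT, hβ₁, hβ₁, hμs, hμs]
    rw [sub_eq_zero]
    congr 1
    ring
  let N : Module.End A (A ⊗[K] C) := { toFun := T, map_add' := map_add T, map_smul' := hTs } - 1
  have hNT : ∀ y, N y = T y - y := fun y => rfl
  -- Reduction modulo ker ε. Against E ⊗ q both β₀ and β₁ depend only on r, and they agree there;
  -- for β₁ this is the relation defining φC.
  let r : A ⊗[K] C →ₗ[K] C := TensorProduct.lid K C ∘ₗ ε.toLinearMap.rTensor C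
  have hr : ∀ a q, r (a ⊗ₜ q) = ε a • q := fun a q => by simp [r]
  have hrm : ∀ v, v - 1 ⊗ₜ r v ∈ RingHom.ker ε • (⊤ : Submodule A (A ⊗[K] C)) := fun v => by
    induction v with
    | zero => simp
    | add x y hx hy =>
      rw [map_add, TensorProduct.tmul_add, add_sub_add_comm]
      exact add_mem hx hy
    | tmul a q =>
      have : a ⊗ₜ q - 1 ⊗ₜ r (a ⊗ₜ q) = (a - algebraMap K A (ε a)) • ((1 : A) ⊗ₜ[K] q) := by
        rw [hr, TensorProduct.smul_tmul', smul_eq_mul, mul_one, TensorProduct.sub_tmul,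
          Algebra.algebraMap_eq_smul_one, TensorProduct.smul_tmul]
      rw [this]
      exact Submodule.smul_mem_smul (by simp [RingHom.mem_ker]) trivial
  have hEr : ∀ q v, β₀ (E ⊗ₜ q) v = φC (q * r v) := fun q v => by
    induction v with
    | zero => simp
    | add x y hx hy => rw [map_add, map_add, hx, hy, mul_add, map_add]
    | tmul a q' =>
      rw [hβ₀, hr, mul_comm E, hE.mul_eq, map_smul, hφA, mul_smul_comm, map_smul, smul_eq_mul,
        smul_eq_mul, mul_one]
  have hEr₁ : ∀ q v, β₁ (E ⊗ₜ q) v = φC (q * r v) := fun q v => by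
    induction v with
    | zero => simp
    | add x y hx hy => rw [map_add, map_add, hx, hy, mul_add, map_add]
    | tmul a q' =>
      rw [hβ₁, hμ, hμ, hr, mul_smul_comm, map_smul]
      have : φC (q * q') = φB (γ E * (s q * s q')) := by rw [← hφC, map_mul π, hs', hs']
      rw [this, ← map_smul, ← smul_mul_assoc, ← map_smul, ← hE.mul_eq, map_mul γ]
      congr 1
      ring
  have hNm : LinearMap.range N ≤ RingHom.ker ε • (⊤ : Submodule A (A ⊗[K] C)) := by
    rintro _ ⟨y, rfl⟩
    -- Agreement against every E ⊗ q, with nondegeneracy on C, puts the image of N in (ker ε)(A ⊗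
    -- C). By A-linearity N^k lands in (ker ε)^k (A ⊗ C), so N is nilpotent.
    have h0 : r (N y) = 0 := hC.2 _ fun q => by
      change φC (q * r (N y)) = 0
      rw [← hEr, hNT, map_sub, hT, hEr, hEr₁, sub_self]
    simpa [h0] using hrm (N y)
  have hNk : ∀ k, LinearMap.range (N ^ k) ≤
      RingHom.ker ε ^ k • (⊤ : Submodule A (A ⊗[K] C)) := by
    intro k
    induction k with
    | zero =>
      rw [pow_zero (RingHom.ker ε), Ideal.one_eq_top, Submodule.top_smul]
      exact le_top
    | succ k ih =>
      rw [pow_succ', Module.End.mul_eq_comp, LinearMap.range_comp]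
      refine (Submodule.map_mono ih).trans ?_
      rw [Submodule.map_smul'', Submodule.map_top, pow_succ, mul_smul]
      exact smul_mono_right _ hNm
  obtain ⟨k, hk⟩ := hE.nilpotent
  have hNnil : IsNilpotent (N.restrictScalars K : Module.End K (A ⊗[K] C)) := by
    refine ⟨k, LinearMap.ext fun v => ?_⟩
    have h0 := hNk k ⟨v, rfl⟩
    rw [hk, Submodule.bot_smul, Submodule.mem_bot] at h0
    rw [Module.End.pow_apply, LinearMap.zero_apply]
    rwa [Module.End.pow_apply] at h0
  obtain ⟨e, he⟩ := LinearMap.BilinForm.exists_isometry_of_isNilpotent h2 hs₀ hs₁ hNnil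
    fun x y => by
      rw [LinearMap.restrictScalars_apply, hNT, add_sub_cancel, hT]
  have hinj : Function.Injective μ := by
    rw [injective_iff_map_eq_zero]
    intro v hv
    obtain ⟨v, rfl⟩ := e.surjective v
    rw [hn₀.1 v fun y => by rw [← he, hβ₁, hv, zero_mul, map_zero], map_zero]
  have hsurj : Function.Surjective μ := by
    -- Nakayama for a nilpotent ideal, which needs no finiteness of B: c - s(π c) lies in γ(ker ε)B,
    -- so γ(a)c is μ(a ⊗ π c) plus a term one power deeper.
    have key : ∀ j ≤ k, ∀ b ∈ (RingHom.ker ε ^ (k - j)).map γ, b ∈ LinearMap.range μ := by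
      intro j
      induction j with
      | zero =>
        intro _ b hb
        rw [Nat.sub_zero, hk, Ideal.map_bot, Ideal.mem_bot] at hb
        rw [hb]
        exact zero_mem _
      | succ j ih =>
        intro hj b hb
        suffices h : ∀ c, c * b ∈ LinearMap.range μ by simpa using h 1
        induction hb using Submodule.span_induction with
        | zero => simp
        | add x y _ _ hx hy => exact fun c => mul_add c x y ▸ add_mem (hx c) (hy c)
        | smul c' x _ hx => exact fun c => by simpa [mul_assoc] using hx (c * c')
        | mem x hx =>
          obtain ⟨a, ha, rfl⟩ := hx
          intro c
          have hc : γ a * (c - s (π c)) ∈ LinearMap.range μ := by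
            refine ih (by omega) _ ?_
            rw [show k - j = k - (j + 1) + 1 by omega, pow_succ, Ideal.map_mul, ← hF.ker_eq]
            exact Ideal.mul_mem_mul (Ideal.mem_map_of_mem γ ha) (by simp [RingHom.mem_ker, hs'])
          have : c * γ a = μ (a ⊗ₜ π c) + γ a * (c - s (π c)) := by
            rw [hμ]
            ring
          exact this ▸ add_mem ⟨_, rfl⟩ hc
    exact fun b => key k le_rfl b (by simp [Ideal.map_top])
  refine ⟨e.trans (LinearEquiv.ofBijective μ ⟨hinj, hsurj⟩), fun a q a' q' => ?_⟩
  rw [← hβ₀, ← he, hβ₁]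
  rfl

end ClosedFibre

end SocleGenerator

/-! ### Degree bounds on supports. -/

namespace MvPolynomial

variable {σ : Type*} {K : Type*} [Field K]

theorem mul_mem_restrictSupport {S T U : Set (σ →₀ ℕ)} {p q : MvPolynomial σ K}
    (hp : p ∈ restrictSupport K S) (hq : q ∈ restrictSupport K T)
    (h : ∀ s ∈ S, ∀ t ∈ T, s + t ∈ U) : p * q ∈ restrictSupport K U := by
  open scoped Pointwise in
  refine restrictSupport_mono K (s := S + T) ?_ ?_
  · rintro _ ⟨s, hs, t, ht, rfl⟩
    exact h s hs t ht
  · rw [restrictSupport_add]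
    exact Submodule.mul_mem_mul hp hq

variable (σ K) in
/-- Polynomials of total degree `< d`. -/
noncomputable abbrev degreeLT (d : ℕ) : Submodule K (MvPolynomial σ K) :=
  restrictSupport K {s | s.degree < d}

variable (σ K) in
/-- Polynomials of total degree `≤ d`. -/
noncomputable abbrev degreeLE (d : ℕ) : Submodule K (MvPolynomial σ K) :=
  restrictSupport K {s | s.degree ≤ d}

theorem degreeLT_le_degreeLE (d : ℕ) : degreeLT σ K d ≤ degreeLE σ K d :=
  restrictSupport_mono K (Set.ofPred_subset_ofPred.mpr fun _ h => le_of_lt h)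

theorem mem_degreeLE_totalDegree (p : MvPolynomial σ K) : p ∈ degreeLE σ K p.totalDegree :=
  fun _ hs => le_totalDegree hs

theorem mem_degreeLT_of_totalDegree_lt {p : MvPolynomial σ K} {d : ℕ} (h : p.totalDegree < d) :
    p ∈ degreeLT σ K d :=
  fun _ hs => (le_totalDegree hs).trans_lt h

theorem mem_degreeLE_of_totalDegree_le {p : MvPolynomial σ K} {d : ℕ} (h : p.totalDegree ≤ d) :
    p ∈ degreeLE σ K d :=
  fun _ hs => (le_totalDegree hs).trans h

theorem prod_mem_degreeLE {ι : Type*} (s : Finset ι) {p : ι → MvPolynomial σ K} {d : ι → ℕ}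
    (h : ∀ i ∈ s, p i ∈ degreeLE σ K (d i)) : ∏ i ∈ s, p i ∈ degreeLE σ K (∑ i ∈ s, d i) := by
  classical
  induction s using Finset.induction_on with
  | empty => exact mem_degreeLE_of_totalDegree_le (by simp)
  | insert a s ha ih =>
    rw [Finset.prod_insert ha, Finset.sum_insert ha]
    refine mul_mem_restrictSupport (h a (by simp)) (ih fun i hi => h i (by simp [hi])) ?_
    intro x hx y hy
    simp only [Set.mem_ofPred_eq, map_add] at *
    omega

theorem pow_mem_degreeLE {p : MvPolynomial σ K} {d : ℕ} (h : p ∈ degreeLE σ K d) (n : ℕ) :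
    p ^ n ∈ degreeLE σ K (n * d) := by
  simpa using prod_mem_degreeLE (Finset.range n) (p := fun _ => p) (d := fun _ => d) fun _ _ => h

theorem X_pow_mem_degreeLE (i : σ) (m : ℕ) : (X i ^ m : MvPolynomial σ K) ∈ degreeLE σ K m :=
  mem_degreeLE_of_totalDegree_le (totalDegree_X_pow i m).le

/-- Adding terms of lower degree to the factors changes a product by terms of lower degree. -/
theorem prod_add_sub_prod_mem_degreeLT {ι : Type*} (s : Finset ι) {p q : ι → MvPolynomial σ K}
    {m : ℕ} (hp : ∀ i, p i ∈ degreeLT σ K m) (hq : ∀ i, q i ∈ degreeLE σ K m) :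
    ∏ i ∈ s, (p i + q i) - ∏ i ∈ s, q i ∈ degreeLT σ K (s.card * m) := by
  classical
  induction s using Finset.induction_on with
  | empty => simp
  | insert a s ha ih =>
    rw [Finset.prod_insert ha, Finset.prod_insert ha, Finset.card_insert_of_notMem ha]
    have e : (p a + q a) * ∏ i ∈ s, (p i + q i) - q a * ∏ i ∈ s, q i =
        p a * ∏ i ∈ s, (p i + q i) + q a * (∏ i ∈ s, (p i + q i) - ∏ i ∈ s, q i) := by ring
    rw [e]
    refine add_mem (mul_mem_restrictSupport (hp a) (prod_mem_degreeLE s (d := fun _ => m)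
      fun i _ => add_mem (degreeLT_le_degreeLE m (hp i)) (hq i)) ?_)
      (mul_mem_restrictSupport (hq a) ih ?_)
    all_goals
      intro x hx y hy
      simp only [Set.mem_ofPred_eq, map_add, Finset.sum_const, smul_eq_mul] at *
      rw [add_mul, one_mul]
      omega

variable [Fintype σ]

variable (σ) in
/-- The exponent of the monomial `∏ᵢ xᵢ ^ m`. -/
noncomputable def boxTop (m : ℕ) : σ →₀ ℕ := Finsupp.equivFunOnFinite.symm fun _ => m

@[simp] theorem boxTop_apply (m : ℕ) (i : σ) : boxTop σ m i = m := rfl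

theorem degree_boxTop (m : ℕ) : (boxTop σ m).degree = Fintype.card σ * m := by
  simp [Finsupp.degree_eq_sum]

theorem monomial_boxTop (m : ℕ) :
    (monomial (boxTop σ m) 1 : MvPolynomial σ K) = ∏ i, X i ^ m := by
  rw [monomial_eq, Finsupp.prod_fintype _ _ (by simp)]
  simp

/-- In each Leibniz term, replacing a factor from the diagonal matrix by an entry of `a` lowers the
degree. -/
theorem det_add_diagonal_sub_mem_degreeLT [DecidableEq σ] {a : Matrix σ σ (MvPolynomial σ K)}
    {m : ℕ} (ha : ∀ i j, a i j ∈ degreeLT σ K m) :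
    (a + Matrix.diagonal fun i => X i ^ m).det - monomial (boxTop σ m) 1 ∈
      degreeLT σ K (Fintype.card σ * m) := by
  rw [monomial_boxTop, ← Matrix.det_diagonal, Matrix.det_apply, Matrix.det_apply,
    ← Finset.sum_sub_distrib]
  refine sum_mem fun τ _ => ?_
  rw [← smul_sub, Units.smul_def]
  refine zsmul_mem (prod_add_sub_prod_mem_degreeLT _ (fun i => ha _ _) fun i => ?_) _
  rw [Matrix.diagonal_apply]
  split_ifs
  · exact X_pow_mem_degreeLE _ _
  · exact zero_mem _

/-! ### The global residue of a system with dominant pure powers. -/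

section Residue

variable (f : σ → MvPolynomial σ K) (m : ℕ)

/-- The terms of the expansion at infinity of the residue of `p / ∏ᵢ (xᵢ ^ (m + 1) + fᵢ)`. -/
noncomputable def residueTerm (k : σ →₀ ℕ) : MvPolynomial σ K →ₗ[K] K :=
  ((-1) ^ k.degree : K) •
    -- Each 1/(x_i^(m+1) + f_i) expands as ∑ (-1)^k f_i^k / x_i^((m+1)(k+1)). The coefficient of ∏
    -- x_i^(-1) is then read off at the exponents (m+1)k_i + m.
    lcoeff K ((m + 1) • k + boxTop σ m) ∘ₗ LinearMap.mulRight K (∏ i, f i ^ k i)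

theorem residueTerm_apply (k : σ →₀ ℕ) (p : MvPolynomial σ K) : residueTerm f m k p =
    (-1) ^ k.degree * coeff ((m + 1) • k + boxTop σ m) (p * ∏ i, f i ^ k i) := rfl

variable {f m}

/-- Multiplying by f^k raises the degree by at most m|k|, while the exponent that is read grows by
(m+1)|k|. So the residue is a finite sum. -/
theorem residueTerm_eq_zero (hf : ∀ i, f i ∈ degreeLE σ K m) {k : σ →₀ ℕ}
    {p : MvPolynomial σ K} {d : ℕ} (hp : p ∈ degreeLE σ K d)
    (hk : d < k.degree + Fintype.card σ * m) : residueTerm f m k p = 0 := by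
  have h : p * ∏ i, f i ^ k i ∈ degreeLE σ K (d + k.degree * m) := by
    refine mul_mem_restrictSupport hp
      (prod_mem_degreeLE Finset.univ fun i _ => pow_mem_degreeLE (hf i) (k i)) ?_
    intro s hs t ht
    rw [← Finset.sum_mul, ← Finsupp.degree_eq_sum] at ht
    simp only [Set.mem_ofPred_eq, map_add] at *
    omega
  rw [residueTerm_apply, mul_eq_zero]
  right
  by_contra h0
  have := h (mem_support_iff.mpr h0)
  rw [Set.mem_ofPred_eq, map_add, map_nsmul, degree_boxTop, smul_eq_mul, add_mul, one_mul,
    mul_comm m] at this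
  omega

theorem finite_support_residueTerm (hf : ∀ i, f i ∈ degreeLE σ K m) (p : MvPolynomial σ K) :
    (Function.support fun k => residueTerm f m k p).Finite := by
  refine (Finsupp.finite_of_degree_le p.totalDegree).subset fun k hk => ?_
  by_contra h
  rw [Set.mem_ofPred_eq, not_le] at h
  exact hk (residueTerm_eq_zero hf (mem_degreeLE_totalDegree p) (by omega))

/-- The global residue functional of the system `xᵢ ^ (m + 1) + fᵢ` with `deg fᵢ ≤ m`. -/
noncomputable def residue (hf : ∀ i, f i ∈ degreeLE σ K m) : MvPolynomial σ K →ₗ[K] K where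
  toFun p := ∑ᶠ k, residueTerm f m k p
  map_add' p q := by
    simp only [map_add]
    exact finsum_add_distrib (finite_support_residueTerm hf p) (finite_support_residueTerm hf q)
  map_smul' c p := by
    simp only [map_smul, RingHom.id_apply]
    exact (smul_finsum _ _).symm

theorem residue_apply (hf : ∀ i, f i ∈ degreeLE σ K m) (p : MvPolynomial σ K) :
    residue hf p = ∑ᶠ k, residueTerm f m k p := rfl

/-- In this range of degrees only the term k = 0 survives. -/
theorem residue_of_mem_degreeLE (hf : ∀ i, f i ∈ degreeLE σ K m) {p : MvPolynomial σ K}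
    (hp : p ∈ degreeLE σ K (Fintype.card σ * m)) : residue hf p = coeff (boxTop σ m) p := by
  rw [residue_apply, finsum_eq_single _ 0 fun k hk => residueTerm_eq_zero hf hp ?_]
  · simp [residueTerm_apply]
  · have : k.degree ≠ 0 := fun h => hk ((Finsupp.degree_eq_zero_iff k).mp h)
    omega

/-- The series telescopes: the term of p x_i^(m+1) at k + e_i cancels that of p f_i at k. The terms
of p x_i^(m+1) with k_i = 0 vanish, because the exponent of x_i read there is only m. -/
theorem residue_mul_eq_zero (hf : ∀ i, f i ∈ degreeLE σ K m) (p : MvPolynomial σ K) (i : σ) :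
    residue hf (p * (f i + X i ^ (m + 1))) = 0 := by
  classical
  have hinj : Function.Injective fun k : σ →₀ ℕ => k + Finsupp.single i 1 :=
    add_left_injective _
  have key : ∀ k, residueTerm f m (k + Finsupp.single i 1) (p * X i ^ (m + 1)) =
      -residueTerm f m k (p * f i) := by
    intro k
    have e1 : (m + 1) • (k + Finsupp.single i 1) + boxTop σ m =
        (m + 1) • k + boxTop σ m + Finsupp.single i (m + 1) := by
      rw [smul_add, Finsupp.smul_single, smul_eq_mul, mul_one, add_right_comm]
    have e2 : ∏ j, f j ^ (k + Finsupp.single i 1 : σ →₀ ℕ) j = (∏ j, f j ^ k j) * f i := by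
      simp only [Finsupp.add_apply, pow_add, Finset.prod_mul_distrib]
      congr 1
      rw [Finset.prod_eq_single i (fun (j : σ) _ hj => by simp [hj.symm]) (by simp)]
      simp
    have e3 : p * X i ^ (m + 1) * ((∏ j, f j ^ k j) * f i) =
        (p * f i * ∏ j, f j ^ k j) * monomial (Finsupp.single i (m + 1)) 1 := by
      rw [← X_pow_eq_monomial]
      ring
    rw [residueTerm_apply, residueTerm_apply, e1, e2, e3, coeff_mul_monomial, map_add,
      Finsupp.degree_single, pow_succ]
    ring
  have hzero : ∀ k, k ∉ Set.range (fun k : σ →₀ ℕ => k + Finsupp.single i 1) →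
      residueTerm f m k (p * X i ^ (m + 1)) = 0 := by
    intro k hk
    have hki : k i = 0 := by
      by_contra h
      refine hk ⟨k - Finsupp.single i 1, tsub_add_cancel_of_le ?_⟩
      rw [Finsupp.single_le_iff]
      omega
    have e3 : p * X i ^ (m + 1) * ∏ j, f j ^ k j =
        (p * ∏ j, f j ^ k j) * monomial (Finsupp.single i (m + 1)) 1 := by
      rw [← X_pow_eq_monomial]
      ring
    rw [residueTerm_apply, e3, coeff_mul_monomial', if_neg, mul_zero]
    rw [Finsupp.single_le_iff]
    simp [hki]
  have hrange : ∑ᶠ k ∈ Set.range fun k : σ →₀ ℕ => k + Finsupp.single i 1,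
      residueTerm f m k (p * X i ^ (m + 1)) = residue hf (p * X i ^ (m + 1)) := by
    rw [finsum_mem_def, Set.indicator_eq_self.mpr, residue_apply]
    intro k hk
    by_contra h
    exact hk (hzero k h)
  rw [mul_add, map_add, ← hrange, finsum_mem_range hinj]
  simp only [key]
  rw [finsum_neg_distrib, residue_apply, add_neg_cancel]

theorem residue_eq_zero_of_mem (hf : ∀ i, f i ∈ degreeLE σ K m) {p : MvPolynomial σ K}
    (hp : p ∈ Ideal.span (Set.range fun i => f i + X i ^ (m + 1))) : residue hf p = 0 := by
  suffices h : ∀ c, residue hf (c * p) = 0 by simpa using h 1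
  induction hp using Submodule.span_induction with
  | zero => simp
  | add x y _ _ hx hy => exact fun c => by rw [mul_add, map_add, hx, hy, add_zero]
  | mem x hx =>
    obtain ⟨i, rfl⟩ := hx
    exact fun c => residue_mul_eq_zero hf c i
  | smul c' x _ hx => exact fun c => by simpa [mul_assoc] using hx (c * c')

/-- Division with remainder: rewriting x_i^(m+1) as -f_i lowers the degree. -/
theorem restrictSupport_sup_span (hf : ∀ i, f i ∈ degreeLE σ K m) :
    restrictSupport K {s | s ≤ boxTop σ m} ⊔
      (Ideal.span (Set.range fun i => f i + X i ^ (m + 1))).restrictScalars K = ⊤ := by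
  have key : ∀ d, ∀ s : σ →₀ ℕ, s.degree < d → ∀ c : K, monomial s c ∈
      restrictSupport K {s | s ≤ boxTop σ m} ⊔
        (Ideal.span (Set.range fun i => f i + X i ^ (m + 1))).restrictScalars K := by
    intro d
    induction d with
    | zero => intro s hs; omega
    | succ d ih =>
      intro s hs c
      by_cases hsm : s ≤ boxTop σ m
      · exact Submodule.mem_sup_left ((monomial_mem_restrictSupport K).mpr (Or.inl hsm))
      · obtain ⟨i, hi⟩ : ∃ i, m < s i := by
          by_contra! h
          exact hsm h
        obtain ⟨t, rfl⟩ : ∃ t, s = t + Finsupp.single i (m + 1) :=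
          ⟨s - Finsupp.single i (m + 1), (tsub_add_cancel_of_le (by
            rw [Finsupp.single_le_iff]; omega)).symm⟩
        rw [map_add, Finsupp.degree_single] at hs
        have e : monomial (t + Finsupp.single i (m + 1)) c =
            monomial t c * (f i + X i ^ (m + 1)) - monomial t c * f i := by
          rw [mul_add, add_sub_cancel_left, X_pow_eq_monomial, monomial_mul, mul_one]
        rw [e]
        refine sub_mem (Submodule.mem_sup_right (Ideal.mul_mem_left _ _
          (Ideal.subset_span ⟨i, rfl⟩))) ?_
        have hd : monomial t c * f i ∈ degreeLT σ K d := by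
          refine mul_mem_restrictSupport (S := {t}) ((monomial_mem_restrictSupport K).mpr (by simp))
            (hf i) ?_
          rintro _ rfl y hy
          rw [Set.mem_ofPred_eq] at *
          rw [map_add]
          omega
        rw [as_sum (monomial t c * f i)]
        exact sum_mem fun s hs => ih s (hd hs) _
  rw [eq_top_iff]
  intro p _
  rw [as_sum p]
  exact sum_mem fun s _ => key _ s (Nat.lt_succ_self _) _

/-- The residue pairing is nondegenerate. -/
theorem mem_of_forall_residue_eq_zero (hf : ∀ i, f i ∈ degreeLE σ K m) {h : MvPolynomial σ K}
    (hh : ∀ p, residue hf (p * h) = 0) :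
    h ∈ Ideal.span (Set.range fun i => f i + X i ^ (m + 1)) := by
  obtain ⟨q, hq, r, hr, rfl⟩ := Submodule.mem_sup.mp
    (restrictSupport_sup_span hf ▸ Submodule.mem_top : h ∈ _)
  have hq0 : ∀ p, residue hf (p * q) = 0 := fun p => by
    have := hh p
    rwa [mul_add, map_add, residue_eq_zero_of_mem hf (Ideal.mul_mem_left _ p hr), add_zero] at this
  suffices q = 0 by rwa [this, zero_add]
  by_contra hne
  -- Pairing the remainder q with the monomial complementary to a top-degree exponent s keeps the
  -- degree within the range where the residue is a plain coefficient, so it returns the coefficient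
  -- of q at s.
  obtain ⟨s, hs, hmax⟩ := q.support.exists_max_image Finsupp.degree (support_nonempty.mpr hne)
  have hsm : s ≤ boxTop σ m := hq hs
  have e : boxTop σ m - s + s = boxTop σ m := tsub_add_cancel_of_le hsm
  have := hq0 (monomial (boxTop σ m - s) 1)
  rw [residue_of_mem_degreeLE, show coeff (boxTop σ m) (monomial (boxTop σ m - s) 1 * q) =
    coeff s q by conv_lhs => rw [← e, add_tsub_cancel_right, coeff_monomial_mul, one_mul]] at this
  · exact mem_support_iff.mp hs this
  · refine mul_mem_restrictSupport (S := {boxTop σ m - s}) (T := {t | t.degree ≤ s.degree})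
      ((monomial_mem_restrictSupport K).mpr (by simp)) hmax ?_
    rintro _ rfl y hy
    have := congrArg Finsupp.degree e
    rw [map_add, degree_boxTop] at this
    rw [Set.mem_ofPred_eq] at *
    rw [map_add]
    omega

theorem residue_det (hf : ∀ i, f i ∈ degreeLE σ K m) [DecidableEq σ]
    {a : Matrix σ σ (MvPolynomial σ K)} (ha : ∀ i j, a i j ∈ degreeLT σ K m) :
    residue hf (a + Matrix.diagonal fun i => X i ^ m).det = 1 := by
  have h := det_add_diagonal_sub_mem_degreeLT ha
  have hmon : residue hf (monomial (boxTop σ m) 1) = 1 := by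
    rw [residue_of_mem_degreeLE, coeff_monomial, if_pos rfl]
    exact (monomial_mem_restrictSupport K).mpr (Or.inl (degree_boxTop m).le)
  rw [← hmon, ← sub_eq_zero, ← map_sub, residue_of_mem_degreeLE hf (degreeLT_le_degreeLE _ h)]
  by_contra h0
  exact (h (mem_support_iff.mpr h0)).ne (degree_boxTop m)

end Residue

end MvPolynomial

/-! ### The local algebra at the origin. -/

namespace PolyMap

open MvPolynomial Filter

variable {K : Type u} [Field K] {n : ℕ}

theorem mem_originIdeal {p : MvPolynomial (Fin n) K} : p ∈ originIdeal K n ↔ eval 0 p = 0 :=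
  RingHom.mem_ker

theorem sub_C_mem_span_X (p : MvPolynomial (Fin n) K) :
    p - C (eval 0 p) ∈ Ideal.span (Set.range (X : Fin n → MvPolynomial (Fin n) K)) := by
  induction p using MvPolynomial.induction_on with
  | C a => simp
  | add p q hp hq =>
    rw [map_add, map_add, add_sub_add_comm]
    exact add_mem hp hq
  | mul_X p i _ =>
    simpa using Ideal.mul_mem_left _ p (Ideal.subset_span (Set.mem_range_self i))

theorem originIdeal_eq_span :
    originIdeal K n = Ideal.span (Set.range (X : Fin n → MvPolynomial (Fin n) K)) := by
  refine le_antisymm (fun p hp => ?_) (Ideal.span_le.mpr ?_)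
  · have := sub_C_mem_span_X p
    rwa [mem_originIdeal.mp hp, map_zero, sub_zero] at this
  · rintro _ ⟨i, rfl⟩
    simp [mem_originIdeal]

/-- Since q - q(0) lies in (x_1, …, x_n), polynomials act on such an h modulo I through their value
at the origin. -/
theorem mul_sub_mem_of_X_mul_mem {I : Ideal (MvPolynomial (Fin n) K)}
    {h : MvPolynomial (Fin n) K} (hI : ∀ i, X i * h ∈ I) (q : MvPolynomial (Fin n) K) :
    q * h - C (eval 0 q) * h ∈ I := by
  have : Ideal.span (Set.range (X : Fin n → MvPolynomial (Fin n) K)) ≤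
      Submodule.comap (LinearMap.toSpanSingleton _ _ h) I := by
    rw [Ideal.span_le]
    rintro _ ⟨i, rfl⟩
    exact hI i
  rw [← sub_mul]
  exact this (sub_C_mem_span_X q)

/-- Cramer's rule. -/
theorem X_mul_det_mem {f : PolyMap K n} {a : Matrix (Fin n) (Fin n) (MvPolynomial (Fin n) K)}
    (ha : ∀ i, f i = ∑ j, a i j * X j) (j : Fin n) :
    X j * a.det ∈ Ideal.span (Set.range f) := by
  have h : f = a.mulVec X := funext ha
  have : X j * a.det = a.adjugate.mulVec f j := by
    rw [h, Matrix.mulVec_mulVec, Matrix.adjugate_mul, Matrix.smul_mulVec, Matrix.one_mulVec,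
      Pi.smul_apply, smul_eq_mul, mul_comm]
  rw [this]
  change ∑ i, a.adjugate j i * f i ∈ _
  exact Ideal.sum_mem _ fun i _ => Ideal.mul_mem_left _ _
    (Ideal.subset_span (Set.mem_range_self i))

/-- The canonical homomorphism from polynomials to the local algebra. -/
noncomputable def toLocalAlgHom (f : PolyMap K n) :
    MvPolynomial (Fin n) K →ₐ[K] f.LocalAlgebra :=
  (Ideal.Quotient.mkₐ K f.localIdeal).comp
    (IsScalarTower.toAlgHom K _ (Localization.AtPrime (originIdeal K n)))

theorem localIdeal_eq_map (f : PolyMap K n) :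
    f.localIdeal = (Ideal.span (Set.range f)).map (algebraMap _ _) := by
  rw [Ideal.map_span, localIdeal, ← Set.range_comp]
  rfl

theorem toLocalAlgHom_eq_zero_iff_mem {f : PolyMap K n} {p : MvPolynomial (Fin n) K} :
    f.toLocalAlgHom p = 0 ↔ algebraMap _ _ p ∈ f.localIdeal :=
  Ideal.Quotient.eq_zero_iff_mem

theorem algebraMap_mem_localIdeal_iff {f : PolyMap K n} {p : MvPolynomial (Fin n) K} :
    algebraMap _ _ p ∈ f.localIdeal ↔
      ∃ s, eval 0 s ≠ 0 ∧ s * p ∈ Ideal.span (Set.range f) := by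
  rw [localIdeal_eq_map,
    IsLocalization.algebraMap_mem_map_algebraMap_iff (originIdeal K n).primeCompl]
  rfl

theorem toLocalAlgHom_eq_zero_iff {f : PolyMap K n} {p : MvPolynomial (Fin n) K} :
    f.toLocalAlgHom p = 0 ↔ ∃ s, eval 0 s ≠ 0 ∧ s * p ∈ Ideal.span (Set.range f) :=
  toLocalAlgHom_eq_zero_iff_mem.trans algebraMap_mem_localIdeal_iff

theorem toLocalAlgHom_of_mem {f : PolyMap K n} {p : MvPolynomial (Fin n) K}
    (hp : p ∈ Ideal.span (Set.range f)) : f.toLocalAlgHom p = 0 :=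
  toLocalAlgHom_eq_zero_iff.mpr ⟨1, by simp, by simpa⟩

theorem toLocalAlgHom_self (f : PolyMap K n) (i : Fin n) : f.toLocalAlgHom (f i) = 0 :=
  toLocalAlgHom_of_mem (Ideal.subset_span ⟨i, rfl⟩)

theorem isUnit_toLocalAlgHom (f : PolyMap K n) {s : MvPolynomial (Fin n) K} (hs : eval 0 s ≠ 0) :
    IsUnit (f.toLocalAlgHom s) :=
  (IsLocalization.map_units (Localization.AtPrime (originIdeal K n))
    (⟨s, hs⟩ : (originIdeal K n).primeCompl)).map (Ideal.Quotient.mk f.localIdeal)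

section Lift

variable {T : Type*} [CommRing T] [Algebra K T] (f : PolyMap K n)
  (θ : MvPolynomial (Fin n) K →ₐ[K] T) (hθ : ∀ s, eval 0 s ≠ 0 → IsUnit (θ s))
  (hf : ∀ i, θ (f i) = 0)

/-- The universal property of the local algebra. -/
noncomputable def liftLocalAlgebra : f.LocalAlgebra →ₐ[K] T :=
  Ideal.Quotient.liftₐ f.localIdeal
    (IsLocalization.liftAlgHom (M := (originIdeal K n).primeCompl) (f := θ) fun s => hθ s s.2) <| by
      have : f.localIdeal ≤ RingHom.ker (IsLocalization.liftAlgHom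
          (S := Localization.AtPrime (originIdeal K n))
          (M := (originIdeal K n).primeCompl) (f := θ) fun s => hθ s s.2) := by
        refine Ideal.span_le.mpr ?_
        rintro _ ⟨i, rfl⟩
        simp [RingHom.mem_ker, hf]
      exact this

theorem liftLocalAlgebra_apply (p : MvPolynomial (Fin n) K) :
    f.liftLocalAlgebra θ hθ hf (f.toLocalAlgHom p) = θ p := by
  change IsLocalization.lift _ (algebraMap _ _ p) = θ p
  exact IsLocalization.lift_eq _ _

end Lift

/-- Evaluation at the origin. -/
noncomputable def augmentation {f : PolyMap K n} (hf₀ : f.FixesOrigin) :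
    f.LocalAlgebra →ₐ[K] K :=
  f.liftLocalAlgebra (aeval 0) (fun s hs => by simpa [coe_aeval_eq_eval] using hs)
    fun i => by simpa [coe_aeval_eq_eval] using hf₀ i

@[simp]
theorem augmentation_apply {f : PolyMap K n} (hf₀ : f.FixesOrigin) (p : MvPolynomial (Fin n) K) :
    augmentation hf₀ (f.toLocalAlgHom p) = eval 0 p := by
  rw [augmentation, liftLocalAlgebra_apply]
  exact DFunLike.congr_fun (coe_aeval_eq_eval 0) p

/-- A prime of the local ring containing the f_i contracts to a point of the fibre lying in every
neighbourhood of the origin, so isolation forces it to be the origin. Hence the maximal ideal lies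
in the radical, and a power of the radical lies in the ideal by Noetherianity. -/
theorem exists_pow_le_localIdeal {f : PolyMap K n} (hf : f.IsolatedAtOrigin) :
    ∃ N, IsLocalRing.maximalIdeal (Localization.AtPrime (originIdeal K n)) ^ N ≤
      f.localIdeal := by
  obtain ⟨U, hU, hU'⟩ := hf
  have h0 : origin K n ∈ U := (hU'.symm ▸ Set.mem_singleton _ : origin K n ∈ U ∩ _).1
  obtain ⟨_, ⟨s, rfl⟩, hs, hsU⟩ :=
    PrimeSpectrum.isTopologicalBasis_basic_opens.exists_subset_of_mem_open h0 hU
  obtain ⟨N, hN⟩ := f.localIdeal.exists_radical_pow_le_of_fg (IsNoetherian.noetherian _)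
  refine ⟨N, le_trans (Ideal.pow_right_mono ?_ N) hN⟩
  rw [Ideal.radical_eq_sInf]
  refine le_sInf fun J hJ => ?_
  obtain ⟨hJ, hJp⟩ := hJ
  let p : PrimeSpectrum (MvPolynomial (Fin n) K) :=
    PrimeSpectrum.comap (algebraMap _ (Localization.AtPrime (originIdeal K n))) ⟨J, hJp⟩
  have hpO : p.asIdeal ≤ originIdeal K n := fun q hq => by
    rw [← IsLocalization.AtPrime.to_map_mem_maximal_iff
      (Localization.AtPrime (originIdeal K n)) (originIdeal K n)]
    exact IsLocalRing.le_maximalIdeal hJp.ne_top hq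
  have hmax : (originIdeal K n).IsMaximal :=
    RingHom.ker_isMaximal_of_surjective _ fun c => ⟨C c, by simp⟩
  have hp : p ∈ U ∩ f.onPoints ⁻¹' {origin K n} := by
    refine ⟨hsU fun hsp => hs (hpO hsp), ?_⟩
    rw [Set.mem_preimage, Set.mem_singleton_iff, PrimeSpectrum.ext_iff, eq_comm]
    refine hmax.eq_of_le (f.onPoints p).2.ne_top ?_
    rw [originIdeal_eq_span, Ideal.span_le]
    rintro _ ⟨i, rfl⟩
    change algebraMap _ _ (aeval f (X i)) ∈ J
    rw [aeval_X]
    exact hJ (Ideal.subset_span ⟨i, rfl⟩)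
  rw [hU', Set.mem_singleton_iff] at hp
  rw [← Localization.AtPrime.map_eq_maximalIdeal, Ideal.map_le_iff_le_comap]
  exact (congrArg PrimeSpectrum.asIdeal hp).ge

section Isolated

variable {f : PolyMap K n} (hf₀ : f.FixesOrigin) (hf : f.IsolatedAtOrigin)

include hf

theorem exists_toLocalAlgHom_eq_zero : ∃ N, ∀ p ∈ originIdeal K n ^ N, f.toLocalAlgHom p = 0 := by
  obtain ⟨N, hN⟩ := exists_pow_le_localIdeal hf
  refine ⟨N, fun p hp => toLocalAlgHom_eq_zero_iff_mem.mpr (hN ?_)⟩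
  rw [← Localization.AtPrime.map_eq_maximalIdeal, ← Ideal.map_pow]
  exact Ideal.mem_map_of_mem _ hp

/-- A denominator s equals s(0)(1 - ν) with ν nilpotent in Q(f), so a finite geometric series
inverts it by a polynomial. -/
theorem toLocalAlgHom_surjective : Function.Surjective f.toLocalAlgHom := by
  obtain ⟨N, hN⟩ := exists_toLocalAlgHom_eq_zero hf
  intro b
  obtain ⟨r, rfl⟩ := Ideal.Quotient.mk_surjective b
  obtain ⟨⟨p, ⟨s, hs⟩⟩, hr⟩ := IsLocalization.surj (originIdeal K n).primeCompl r
  replace hs : eval 0 s ≠ 0 := hs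
  have hr' : Ideal.Quotient.mk f.localIdeal r * f.toLocalAlgHom s = f.toLocalAlgHom p :=
    (map_mul (Ideal.Quotient.mk f.localIdeal) _ _).symm.trans
      (congrArg (Ideal.Quotient.mk f.localIdeal) hr)
  set ν : MvPolynomial (Fin n) K := 1 - C (eval 0 s)⁻¹ * s with hν
  have hνO : ν ∈ originIdeal K n := by
    rw [mem_originIdeal, hν, map_sub, map_one, map_mul, eval_C, inv_mul_cancel₀ hs, sub_self]
  have hinv := congrArg f.toLocalAlgHom (geom_sum_mul_neg ν N)
  rw [map_sub, hN _ (Ideal.pow_mem_pow hνO N), map_one, sub_zero, map_mul, hν,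
    sub_sub_cancel] at hinv
  refine ⟨p * ((∑ i ∈ Finset.range N, ν ^ i) * C (eval 0 s)⁻¹), ?_⟩
  rw [map_mul] at hinv
  rw [map_mul, ← hr', map_mul]
  linear_combination Ideal.Quotient.mk f.localIdeal r * hinv

theorem ker_augmentation :
    RingHom.ker (augmentation hf₀) = (originIdeal K n).map f.toLocalAlgHom := by
  refine le_antisymm (fun b hb => ?_) ?_
  · obtain ⟨p, rfl⟩ := toLocalAlgHom_surjective hf b
    rw [RingHom.mem_ker, augmentation_apply] at hb
    exact Ideal.mem_map_of_mem _ (mem_originIdeal.mpr hb)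
  · rw [Ideal.map_le_iff_le_comap]
    intro p hp
    rwa [Ideal.mem_comap, RingHom.mem_ker, augmentation_apply, ← mem_originIdeal]

theorem ker_augmentation_nilpotent : ∃ N, RingHom.ker (augmentation hf₀) ^ N = ⊥ := by
  obtain ⟨N, hN⟩ := exists_toLocalAlgHom_eq_zero hf
  refine ⟨N, ?_⟩
  rw [ker_augmentation hf₀ hf, eq_bot_iff]
  exact (Ideal.map_pow (S := f.LocalAlgebra) f.toLocalAlgHom _ N).ge.trans
    (Ideal.map_le_iff_le_comap.mpr fun p hp => hN p hp)

/-- Stated for all large m so that it can be combined with the degree bounds needed by the residue.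
-/
theorem eventually_toLocalAlgHom_X_pow :
    ∀ᶠ m in atTop, ∀ i, f.toLocalAlgHom (X i ^ m) = 0 := by
  obtain ⟨N, hN⟩ := exists_toLocalAlgHom_eq_zero hf
  filter_upwards [eventually_ge_atTop N] with m hm i
  exact hN _ (Ideal.pow_le_pow_right hm (Ideal.pow_mem_pow (by simp [mem_originIdeal]) m))

end Isolated

theorem eventually_mem_degreeLE (f : PolyMap K n) :
    ∀ᶠ m in atTop, ∀ i, f i ∈ degreeLE (Fin n) K m :=
  eventually_all.mpr fun i => (eventually_ge_atTop (f i).totalDegree).mono fun _ h =>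
    mem_degreeLE_of_totalDegree_le h

theorem eventually_mem_degreeLT (a : Matrix (Fin n) (Fin n) (MvPolynomial (Fin n) K)) :
    ∀ᶠ m in atTop, ∀ i j, a i j ∈ degreeLT (Fin n) K m :=
  eventually_all.mpr fun i => eventually_all.mpr fun j =>
    (eventually_gt_atTop (a i j).totalDegree).mono fun _ h => mem_degreeLT_of_totalDegree_lt h

/-- By Nakayama's lemma, perturbations in `𝔪 I` of generators of `I` are again generators. -/
theorem _root_.Ideal.span_range_add_eq {R ι : Type*} [CommRing R] [IsLocalRing R]
    [IsNoetherianRing R] {f x : ι → R}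
    (hx : ∀ i, x i ∈ IsLocalRing.maximalIdeal R * Ideal.span (Set.range f)) :
    Ideal.span (Set.range fun i => f i + x i) = Ideal.span (Set.range f) := by
  have hle : IsLocalRing.maximalIdeal R * Ideal.span (Set.range f) ≤ Ideal.span (Set.range f) :=
    Ideal.mul_le_right
  refine le_antisymm (Ideal.span_le.mpr ?_) ?_
  · rintro _ ⟨i, rfl⟩
    exact Ideal.add_mem _ (Ideal.subset_span (Set.mem_range_self i)) (hle (hx i))
  · refine Submodule.le_of_le_smul_of_le_jacobson_bot (IsNoetherian.noetherian _)
      (IsLocalRing.maximalIdeal_le_jacobson ⊥) (Ideal.span_le.mpr ?_)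
    rintro _ ⟨i, rfl⟩
    have h1 : f i + x i ∈ Ideal.span (Set.range fun i => f i + x i) :=
      Ideal.subset_span (Set.mem_range_self i)
    have h2 := sub_mem (Submodule.mem_sup_left h1) (Submodule.mem_sup_right (hx i))
    rwa [add_sub_cancel_right] at h2

theorem _root_.Matrix.map_det_congr {ι R S : Type*} [Fintype ι] [DecidableEq ι] [CommRing R]
    [CommRing S] (φ : R →+* S) {a b : Matrix ι ι R} (h : ∀ i j, φ (a i j) = φ (b i j)) :
    φ a.det = φ b.det := by
  rw [RingHom.map_det, RingHom.map_det]
  congr 1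
  ext i j
  exact h i j

/-- The perturbation of `f` by the powers `xᵢ ^ (m + 1)`. -/
noncomputable abbrev perturb (f : PolyMap K n) (m : ℕ) : PolyMap K n :=
  fun i => f i + X i ^ (m + 1)

section Perturb

variable {f : PolyMap K n} {m : ℕ}

/-- The power x_i^m is already in the ideal; the one extra factor x_i puts the perturbation in 𝔪
times the ideal, as Nakayama requires. -/
theorem localIdeal_perturb (hm : ∀ i, f.toLocalAlgHom (X i ^ m) = 0) :
    (f.perturb m).localIdeal = f.localIdeal := by
  have hX : ∀ i : Fin n, algebraMap (MvPolynomial (Fin n) K)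
      (Localization.AtPrime (originIdeal K n)) (X i ^ (m + 1)) ∈
      IsLocalRing.maximalIdeal (Localization.AtPrime (originIdeal K n)) * f.localIdeal := by
    intro i
    rw [pow_succ', map_mul]
    refine Ideal.mul_mem_mul ?_ (toLocalAlgHom_eq_zero_iff_mem.mp (hm i))
    rw [IsLocalization.AtPrime.to_map_mem_maximal_iff _ (originIdeal K n)]
    simp [mem_originIdeal]
  simp only [localIdeal, map_add]
  exact Ideal.span_range_add_eq hX

theorem toLocalAlgHom_eq_zero_iff_perturb (hm : ∀ i, f.toLocalAlgHom (X i ^ m) = 0)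
    {p : MvPolynomial (Fin n) K} : f.toLocalAlgHom p = 0 ↔
      ∃ s, eval 0 s ≠ 0 ∧ s * p ∈ Ideal.span (Set.range (f.perturb m)) := by
  rw [toLocalAlgHom_eq_zero_iff_mem, ← localIdeal_perturb hm, algebraMap_mem_localIdeal_iff]

theorem toLocalAlgHom_of_mem_perturb (hm : ∀ i, f.toLocalAlgHom (X i ^ m) = 0)
    {p : MvPolynomial (Fin n) K} (hp : p ∈ Ideal.span (Set.range (f.perturb m))) :
    f.toLocalAlgHom p = 0 :=
  (toLocalAlgHom_eq_zero_iff_perturb hm).mpr ⟨1, by simp, by simpa⟩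

theorem perturb_eq_sum {a : Matrix (Fin n) (Fin n) (MvPolynomial (Fin n) K)}
    (ha : ∀ i, f i = ∑ j, a i j * X j) (i : Fin n) : f.perturb m i =
      ∑ j, (a + Matrix.diagonal fun i => X i ^ m : Matrix _ _ _) i j * X j := by
  simp [perturb, ha, Matrix.add_apply, add_mul, Finset.sum_add_distrib, Matrix.diagonal_apply,
    pow_succ]

theorem toLocalAlgHom_det_perturb (hm : ∀ i, f.toLocalAlgHom (X i ^ m) = 0)
    (a : Matrix (Fin n) (Fin n) (MvPolynomial (Fin n) K)) :
    f.toLocalAlgHom (a + Matrix.diagonal fun i => X i ^ m).det = f.toLocalAlgHom a.det := by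
  refine Matrix.map_det_congr (S := f.LocalAlgebra)
    (a := a + Matrix.diagonal fun i => X i ^ m) (b := a) f.toLocalAlgHom.toRingHom fun i j => ?_
  change f.toLocalAlgHom _ = f.toLocalAlgHom _
  by_cases h : i = j
  · subst h
    rw [Matrix.add_apply, Matrix.diagonal_apply_eq, map_add, hm, add_zero]
  · rw [Matrix.add_apply, Matrix.diagonal_apply_ne _ h, add_zero]

/-- The residue of qp is q(0) times that of p, hence zero, and the pairing is nondegenerate. So
modulo the perturbed ideal, elements killed by all x_i are determined by their residue. -/
theorem mem_perturb_of_X_mul_mem (hf : ∀ i, f i ∈ degreeLE (Fin n) K m)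
    {p : MvPolynomial (Fin n) K} (hp : ∀ i, X i * p ∈ Ideal.span (Set.range (f.perturb m)))
    (h0 : residue hf p = 0) : p ∈ Ideal.span (Set.range (f.perturb m)) := by
  refine mem_of_forall_residue_eq_zero hf fun q => ?_
  have := residue_eq_zero_of_mem hf (mul_sub_mem_of_X_mul_mem hp q)
  rwa [map_sub, ← smul_eq_C_mul, map_smul, h0, smul_zero, sub_zero] at this

end Perturb

/-! ### Finiteness and socle of the local algebra, via the residue. -/

section Isolated

variable {f : PolyMap K n} (hf₀ : f.FixesOrigin) (hf : f.IsolatedAtOrigin)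

include hf

theorem finite_localAlgebra : Module.Finite K f.LocalAlgebra := by
  obtain ⟨m, hm, hfm⟩ := ((eventually_toLocalAlgHom_X_pow hf).and
    (eventually_mem_degreeLE f)).exists
  have h := congrArg (Submodule.map f.toLocalAlgHom.toLinearMap) (restrictSupport_sup_span hfm)
  rw [Submodule.map_sup, Submodule.map_top, LinearMap.range_eq_top.mpr
    (toLocalAlgHom_surjective hf), sup_eq_left.mpr] at h
  · rw [Module.finite_def, ← h, restrictSupport_eq_span]
    exact (Submodule.fg_span ((Set.finite_Iic _).image _)).map _
  · rintro _ ⟨p, hp, rfl⟩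
    have : f.toLocalAlgHom p = 0 := toLocalAlgHom_of_mem_perturb hm hp
    simp [this]

/-- After perturbation both determinants are killed by the x_i (Cramer) and have residue 1, so their
difference lies in the perturbed ideal. -/
theorem toLocalAlgHom_det_unique {a b : Matrix (Fin n) (Fin n) (MvPolynomial (Fin n) K)}
    (ha : ∀ i, f i = ∑ j, a i j * X j) (hb : ∀ i, f i = ∑ j, b i j * X j) :
    f.toLocalAlgHom a.det = f.toLocalAlgHom b.det := by
  obtain ⟨m, hm, hfm, ham, hbm⟩ := ((eventually_toLocalAlgHom_X_pow hf).and
    ((eventually_mem_degreeLE f).and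
      ((eventually_mem_degreeLT a).and (eventually_mem_degreeLT b)))).exists
  rw [← toLocalAlgHom_det_perturb hm a, ← toLocalAlgHom_det_perturb hm b, ← sub_eq_zero, ← map_sub]
  refine toLocalAlgHom_of_mem_perturb hm (mem_perturb_of_X_mul_mem hfm (fun i => ?_) ?_)
  · rw [mul_sub]
    exact sub_mem (X_mul_det_mem (perturb_eq_sum ha) i) (X_mul_det_mem (perturb_eq_sum hb) i)
  · rw [map_sub, residue_det hfm ham, residue_det hfm hbm, sub_self]

theorem isSocleGenerator_det {a : Matrix (Fin n) (Fin n) (MvPolynomial (Fin n) K)}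
    (ha : ∀ i, f i = ∑ j, a i j * X j) :
    IsSocleGenerator (augmentation hf₀) (f.toLocalAlgHom a.det) := by
  obtain ⟨m, hm, hfm, ham⟩ := ((eventually_toLocalAlgHom_X_pow hf).and
    ((eventually_mem_degreeLE f).and (eventually_mem_degreeLT a))).exists
  rw [← toLocalAlgHom_det_perturb hm a]
  have hX := X_mul_det_mem (perturb_eq_sum (m := m) ha)
  have h1 := residue_det hfm ham
  set d := (a + Matrix.diagonal fun i => X i ^ m).det
  refine ⟨ker_augmentation_nilpotent hf₀ hf, fun h => ?_, fun b => ?_, fun b hb => ?_⟩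
  -- If sd lay in the perturbed ideal, its residue s(0) · 1 would vanish.
  · obtain ⟨s, hs, hsd⟩ := (toLocalAlgHom_eq_zero_iff_perturb hm).mp h
    have h2 := residue_eq_zero_of_mem hfm (mul_sub_mem_of_X_mul_mem hX s)
    rw [map_sub, residue_eq_zero_of_mem hfm hsd, ← smul_eq_C_mul, map_smul, h1,
      smul_eq_mul, mul_one, zero_sub, neg_eq_zero] at h2
    exact hs h2
  · obtain ⟨q, rfl⟩ := toLocalAlgHom_surjective hf b
    rw [augmentation_apply, ← map_mul, ← map_smul, smul_eq_C_mul, ← sub_eq_zero, ← map_sub]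
    exact toLocalAlgHom_of_mem_perturb hm (mul_sub_mem_of_X_mul_mem hX q)
  · obtain ⟨p, rfl⟩ := toLocalAlgHom_surjective hf b
    have hp : ∀ i, ∃ s, eval 0 s ≠ 0 ∧ s * (X i * p) ∈ Ideal.span (Set.range (f.perturb m)) :=
      fun i => (toLocalAlgHom_eq_zero_iff_perturb hm).mp (by
        rw [map_mul]
        exact hb _ (by simp))
    -- The product S of these denominators works for all i at once. Then Sp minus its residue times
    -- d is killed by the x_i and has residue 0, so it vanishes in Q(f). As S acts on the class b of
    -- p as S(0) ≠ 0, this solves for b.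
    choose s hs hsp using hp
    have hS : eval 0 (∏ i, s i) ≠ 0 := by
      rw [map_prod]
      exact Finset.prod_ne_zero_iff.mpr fun i _ => hs i
    have hSp : ∀ i, X i * ((∏ i, s i) * p) ∈ Ideal.span (Set.range (f.perturb m)) := fun i => by
      obtain ⟨t, ht⟩ := Finset.dvd_prod_of_mem s (Finset.mem_univ i)
      have : X i * ((∏ i, s i) * p) = t * (s i * (X i * p)) := by
        rw [ht]
        ring
      exact this ▸ Ideal.mul_mem_left _ t (hsp i)
    have h3 := toLocalAlgHom_of_mem_perturb hm (mem_perturb_of_X_mul_mem hfm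
      (p := (∏ i, s i) * p - C (residue hfm ((∏ i, s i) * p)) * d) (fun i => by
        rw [mul_sub, mul_left_comm _ (C _)]
        exact sub_mem (hSp i) (Ideal.mul_mem_left _ _ (hX i))) (by
        rw [map_sub, ← smul_eq_C_mul, map_smul, h1, smul_eq_mul, mul_one, sub_self]))
    have h4 := hb (f.toLocalAlgHom ((∏ i, s i) - C (eval 0 (∏ i, s i)))) (by simp)
    rw [map_sub, sub_mul, ← map_mul, ← map_mul, ← smul_eq_C_mul, map_smul, sub_eq_zero] at h4
    rw [map_sub, ← smul_eq_C_mul, map_smul, h4, sub_eq_zero] at h3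
    refine ⟨(eval 0 (∏ i, s i))⁻¹ * residue hfm ((∏ i, s i) * p), ?_⟩
    rw [mul_smul, ← h3, inv_smul_smul₀ hS]

end Isolated

end PolyMap

namespace PolyMap

open MvPolynomial

variable {K : Type u} [Field K] {n : ℕ}

/-! ### Existence and independence of the degree. -/

section Degree

variable {f : PolyMap K n}

theorem FixesOrigin.exists_matrix (hf₀ : f.FixesOrigin) :
    ∃ a : Matrix (Fin n) (Fin n) (MvPolynomial (Fin n) K), ∀ i, f i = ∑ j, a i j * X j := by
  have h : ∀ i, ∃ c : Fin n → MvPolynomial (Fin n) K, ∑ j, c j * X j = f i := fun i => by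
    rw [← Ideal.mem_span_range_iff_exists_fun, ← originIdeal_eq_span]
    exact hf₀ i
  choose a ha using h
  exact ⟨a, fun i => (ha i).symm⟩

theorem isNormalized_iff (hf : f.IsolatedAtOrigin)
    {a : Matrix (Fin n) (Fin n) (MvPolynomial (Fin n) K)}
    (ha : ∀ i, f i = ∑ j, a i j * X j) {φ : f.LocalAlgebra →ₗ[K] K} :
    f.IsNormalized φ ↔ φ (f.toLocalAlgHom a.det) = 1 := by
  constructor
  · rintro ⟨_, ⟨b, hb, rfl⟩, h⟩
    rwa [toLocalAlgHom_det_unique hf ha hb]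
  · exact fun h => ⟨_, ⟨a, ha, rfl⟩, h⟩

theorem exists_isNormalized (hf₀ : f.FixesOrigin) (hf : f.IsolatedAtOrigin) :
    ∃ φ, f.IsNormalized φ := by
  obtain ⟨a, ha⟩ := hf₀.exists_matrix
  have h0 := (isSocleGenerator_det hf₀ hf ha).ne_zero
  rw [Ne, ← Module.forall_dual_apply_eq_zero_iff K, not_forall] at h0
  obtain ⟨φ, hφ⟩ := h0
  refine ⟨(φ (f.toLocalAlgHom a.det))⁻¹ • φ, (isNormalized_iff hf ha).mpr ?_⟩
  rw [LinearMap.smul_apply, smul_eq_mul, inv_mul_cancel₀ hφ]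

theorem IsNormalized.nondegenerate (hf₀ : f.FixesOrigin) (hf : f.IsolatedAtOrigin)
    {φ : f.LocalAlgebra →ₗ[K] K} (hφ : f.IsNormalized φ) : (f.bilin φ).Nondegenerate := by
  obtain ⟨a, ha⟩ := hf₀.exists_matrix
  exact (isSocleGenerator_det hf₀ hf ha).nondegenerate ((isNormalized_iff hf ha).mp hφ)

/-- The form `β_φ` as a bilinear space. -/
noncomputable abbrev bilinSpace (hf₀ : f.FixesOrigin) (hf : f.IsolatedAtOrigin)
    {φ : f.LocalAlgebra →ₗ[K] K} (hφ : f.IsNormalized φ) : SymmBilinSpace K :=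
  have := finite_localAlgebra hf
  { V := f.LocalAlgebra, form := f.bilin φ, symm := f.bilin_symm φ,
    nondegenerate := hφ.nondegenerate hf₀ hf }

/-- Any two normalized functionals take the value 1 on the same socle generator, so their forms are
isometric. -/
theorem isEKLDegree_cls (h2 : (2 : K) ≠ 0) (hf₀ : f.FixesOrigin) (hf : f.IsolatedAtOrigin)
    {φ : f.LocalAlgebra →ₗ[K] K} (hφ : f.IsNormalized φ) :
    f.IsEKLDegree (GW.cls (bilinSpace hf₀ hf hφ)) := by
  obtain ⟨a, ha⟩ := hf₀.exists_matrix
  have hfin := finite_localAlgebra hf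
  refine ⟨⟨φ, hφ⟩, fun φ' hφ' => ⟨hfin, hφ'.nondegenerate hf₀ hf, ?_⟩⟩
  obtain ⟨e, he⟩ := (isSocleGenerator_det hf₀ hf ha).exists_isometry h2
    ((isNormalized_iff hf ha).mp hφ') ((isNormalized_iff hf ha).mp hφ)
  exact GW.cls_eq ⟨{ e with map_app' := he }⟩

end Degree

/-! ### Composition and multiplicativity. -/

section Comp

variable {f g : PolyMap K n}

theorem FixesOrigin.eval_aeval (hg₀ : g.FixesOrigin) (p : MvPolynomial (Fin n) K) :
    eval 0 (aeval g p) = eval 0 p := by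
  have h : (eval (0 : Fin n → K)).comp (aeval g).toRingHom = eval 0 := by
    refine ringHom_ext (fun c => by simp) fun i => ?_
    simpa using hg₀ i
  exact DFunLike.congr_fun h p

theorem FixesOrigin.comp (hf₀ : f.FixesOrigin) (hg₀ : g.FixesOrigin) :
    (f.comp g).FixesOrigin := fun i => (hg₀.eval_aeval (f i)).trans (hf₀ i)

theorem aeval_comp (f g : PolyMap K n) (p : MvPolynomial (Fin n) K) :
    aeval (f.comp g) p = aeval g (aeval f p) := by
  have h : aeval (f.comp g) = (aeval g).comp (aeval f : _ →ₐ[K] MvPolynomial (Fin n) K) := by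
    ext i
    simp [PolyMap.comp]
  exact DFunLike.congr_fun h p

theorem mem_onPoints {p : PrimeSpectrum (MvPolynomial (Fin n) K)} {q : MvPolynomial (Fin n) K} :
    q ∈ (f.onPoints p).asIdeal ↔ aeval f q ∈ p.asIdeal :=
  Iff.rfl

theorem onPoints_comp (p : PrimeSpectrum (MvPolynomial (Fin n) K)) :
    (f.comp g).onPoints p = f.onPoints (g.onPoints p) := by
  ext q
  rw [mem_onPoints, mem_onPoints, mem_onPoints, aeval_comp]

theorem IsolatedAtOrigin.comp (hf : f.IsolatedAtOrigin) (hg : g.IsolatedAtOrigin) :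
    (f.comp g).IsolatedAtOrigin := by
  obtain ⟨U, hU, hU'⟩ := hf
  obtain ⟨V, hV, hV'⟩ := hg
  simp only [Set.ext_iff, Set.mem_inter_iff, Set.mem_preimage, Set.mem_singleton_iff] at hU' hV'
  have hf0 := (hU' (origin K n)).mpr rfl
  have hg0 := (hV' (origin K n)).mpr rfl
  refine ⟨V ∩ g.onPoints ⁻¹' U, hV.inter (hU.preimage (PrimeSpectrum.continuous_comap _)), ?_⟩
  ext p
  simp only [Set.mem_inter_iff, Set.mem_preimage, Set.mem_singleton_iff, onPoints_comp]
  constructor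
  · rintro ⟨⟨hpV, hpU⟩, hp⟩
    exact (hV' p).mp ⟨hpV, (hU' _).mp ⟨hpU, hp⟩⟩
  · intro hp
    rw [hp, hg0.2]
    exact ⟨⟨hg0.1, hf0.1⟩, hf0.2⟩

theorem aeval_mem_span {p : MvPolynomial (Fin n) K} (hp : p ∈ originIdeal K n) :
    aeval g p ∈ Ideal.span (Set.range g) := by
  have h : originIdeal K n ≤ (Ideal.span (Set.range g)).comap (aeval g) := by
    rw [originIdeal_eq_span, Ideal.span_le]
    rintro _ ⟨i, rfl⟩
    rw [SetLike.mem_coe, Ideal.mem_comap, aeval_X]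
    exact Ideal.subset_span ⟨i, rfl⟩
  exact h hp

theorem toLocalAlgHom_comp_aeval_self (f g : PolyMap K n) (i : Fin n) :
    ((f.comp g).toLocalAlgHom.comp (aeval g)) (f i) = 0 := by
  rw [AlgHom.comp_apply]
  exact (f.comp g).toLocalAlgHom_self i

theorem FixesOrigin.isUnit_toLocalAlgHom_comp_aeval (f : PolyMap K n) (hg₀ : g.FixesOrigin)
    (s : MvPolynomial (Fin n) K) (hs : eval 0 s ≠ 0) :
    IsUnit (((f.comp g).toLocalAlgHom.comp (aeval g)) s) := by
  rw [AlgHom.comp_apply]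
  refine isUnit_toLocalAlgHom _ ?_
  rwa [hg₀.eval_aeval]

theorem FixesOrigin.toLocalAlgHom_comp (hf₀ : f.FixesOrigin) (g : PolyMap K n) (i : Fin n) :
    g.toLocalAlgHom (f.comp g i) = 0 :=
  toLocalAlgHom_of_mem (aeval_mem_span (mem_originIdeal.mpr (hf₀ i)))

/-- The homomorphism `Q(f) → Q(f ∘ g)` induced by `g`. -/
noncomputable def localPullback (f : PolyMap K n) (hg₀ : g.FixesOrigin) :
    f.LocalAlgebra →ₐ[K] (f.comp g).LocalAlgebra :=
  f.liftLocalAlgebra (T := (f.comp g).LocalAlgebra) ((f.comp g).toLocalAlgHom.comp (aeval g))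
    (hg₀.isUnit_toLocalAlgHom_comp_aeval f) (toLocalAlgHom_comp_aeval_self f g)

theorem localPullback_apply (hg₀ : g.FixesOrigin) (p : MvPolynomial (Fin n) K) :
    localPullback f hg₀ (f.toLocalAlgHom p) = (f.comp g).toLocalAlgHom (aeval g p) := by
  exact liftLocalAlgebra_apply (T := (f.comp g).LocalAlgebra) f _ _ _ p

/-- The projection `Q(f ∘ g) → Q(g)`. -/
noncomputable def toFibre (hf₀ : f.FixesOrigin) (g : PolyMap K n) :
    (f.comp g).LocalAlgebra →ₐ[K] g.LocalAlgebra :=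
  (f.comp g).liftLocalAlgebra (T := g.LocalAlgebra) g.toLocalAlgHom (fun _ => g.isUnit_toLocalAlgHom)
    (hf₀.toLocalAlgHom_comp g)

theorem toFibre_apply (hf₀ : f.FixesOrigin) (p : MvPolynomial (Fin n) K) :
    toFibre hf₀ g ((f.comp g).toLocalAlgHom p) = g.toLocalAlgHom p := by
  exact liftLocalAlgebra_apply (T := g.LocalAlgebra) (f.comp g) _ _ _ p

theorem toFibre_surjective (hf₀ : f.FixesOrigin) (hg : g.IsolatedAtOrigin) :
    Function.Surjective (toFibre hf₀ g) := fun b => by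
  obtain ⟨p, rfl⟩ := toLocalAlgHom_surjective hg b
  exact ⟨_, toFibre_apply hf₀ p⟩

/-- The pullback sends x_i to g_i, so killing the image of the maximal ideal of Q(f) imposes exactly
the equations of Q(g). -/
theorem isClosedFibre (hf₀ : f.FixesOrigin) (hf : f.IsolatedAtOrigin) (hg₀ : g.FixesOrigin)
    (hg : g.IsolatedAtOrigin) :
    IsClosedFibre (A := f.LocalAlgebra) (B := (f.comp g).LocalAlgebra) (C := g.LocalAlgebra)
      (augmentation hf₀) (localPullback f hg₀) (toFibre hf₀ g) := by
  refine .of_sum (A := f.LocalAlgebra) (B := (f.comp g).LocalAlgebra) (C := g.LocalAlgebra)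
    (toFibre_surjective hf₀ hg) (fun b hb => ?_)
    (x := fun i => f.toLocalAlgHom (X i)) (fun i => by simp) (fun b hb => ?_)
  · obtain ⟨p, rfl⟩ := toLocalAlgHom_surjective hf b
    rw [augmentation_apply] at hb
    rw [localPullback_apply, toFibre_apply]
    exact toLocalAlgHom_of_mem (aeval_mem_span (mem_originIdeal.mpr hb))
  · obtain ⟨p, rfl⟩ := toLocalAlgHom_surjective (hf.comp hg) b
    rw [toFibre_apply, toLocalAlgHom_eq_zero_iff] at hb
    obtain ⟨s, hs, hsp⟩ := hb
    obtain ⟨c, hc⟩ := Ideal.mem_span_range_iff_exists_fun.mp hsp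
    -- The denominator s was introduced in Q(g), but s(0) ≠ 0 makes it invertible in Q(f∘g) too.
    obtain ⟨t, ht⟩ := ((f.comp g).isUnit_toLocalAlgHom hs).exists_left_inv
    refine ⟨fun i => t * (f.comp g).toLocalAlgHom (c i), ?_⟩
    have h := congrArg (f.comp g).toLocalAlgHom hc
    rw [map_sum, map_mul] at h
    calc (f.comp g).toLocalAlgHom p
        = t * ((f.comp g).toLocalAlgHom s * (f.comp g).toLocalAlgHom p) := by
          rw [← mul_assoc, ht, one_mul]
      _ = _ := by
          rw [← h, Finset.mul_sum]
          refine Finset.sum_congr rfl fun i _ => ?_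
          rw [localPullback_apply, aeval_X, map_mul, mul_assoc]

/-- The chain rule for the matrices that define the socle elements. -/
theorem comp_eq_sum {a b : Matrix (Fin n) (Fin n) (MvPolynomial (Fin n) K)}
    (ha : ∀ i, f i = ∑ j, a i j * X j) (hb : ∀ i, g i = ∑ j, b i j * X j) (i : Fin n) :
    f.comp g i = ∑ j, ((aeval g).mapMatrix a * b : Matrix _ _ _) i j * X j := by
  simp only [PolyMap.comp, Matrix.mul_apply, Finset.sum_mul]
  rw [Finset.sum_comm, ha, map_sum]
  refine Finset.sum_congr rfl fun j _ => ?_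
  rw [map_mul, aeval_X, hb, Finset.mul_sum]
  exact Finset.sum_congr rfl fun k _ => (mul_assoc _ _ _).symm

theorem det_comp (a b : Matrix (Fin n) (Fin n) (MvPolynomial (Fin n) K)) :
    ((aeval g).mapMatrix a * b : Matrix _ _ _).det = aeval g a.det * b.det := by
  rw [Matrix.det_mul, AlgHom.map_det]

/-- By the chain rule γ(E(f)) times a lift of E(g) is E(f∘g), so ψ(E(g)) = χ(E(f∘g)) = 1. -/
theorem isNormalized_fibre (hf₀ : f.FixesOrigin)
    (hf : f.IsolatedAtOrigin) (hg₀ : g.FixesOrigin) (hg : g.IsolatedAtOrigin)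
    {a : Matrix (Fin n) (Fin n) (MvPolynomial (Fin n) K)} (ha : ∀ i, f i = ∑ j, a i j * X j)
    {χ : (f.comp g).LocalAlgebra →ₗ[K] K} (hχ : (f.comp g).IsNormalized χ)
    {ψ : g.LocalAlgebra →ₗ[K] K} (hψχ : ∀ b, ψ (toFibre hf₀ g b) =
      χ (localPullback f hg₀ (f.toLocalAlgHom a.det) * b)) : g.IsNormalized ψ := by
  obtain ⟨b, hb⟩ := hg₀.exists_matrix
  have h := (isNormalized_iff (hf.comp hg) (comp_eq_sum ha hb)).mp hχ
  rw [det_comp] at h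
  have h' := hψχ ((f.comp g).toLocalAlgHom b.det)
  rw [toFibre_apply, localPullback_apply, ← map_mul, h] at h'
  exact (isNormalized_iff hg hb).mpr h'

theorem exists_fibre_functional (hf₀ : f.FixesOrigin)
    (hf : f.IsolatedAtOrigin) (hg₀ : g.FixesOrigin) (hg : g.IsolatedAtOrigin)
    {a : Matrix (Fin n) (Fin n) (MvPolynomial (Fin n) K)} (ha : ∀ i, f i = ∑ j, a i j * X j)
    (χ : (f.comp g).LocalAlgebra →ₗ[K] K) :
    ∃ ψ : g.LocalAlgebra →ₗ[K] K, ∀ b, ψ (toFibre hf₀ g b) =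
      χ (localPullback f hg₀ (f.toLocalAlgHom a.det) * b) := by
  exact IsSocleGenerator.exists_fibre_functional (A := f.LocalAlgebra)
    (B := (f.comp g).LocalAlgebra) (C := g.LocalAlgebra) (isSocleGenerator_det hf₀ hf ha)
    (isClosedFibre hf₀ hf hg₀ hg) χ

theorem exists_tensor_isometry (h2 : (2 : K) ≠ 0) (hf₀ : f.FixesOrigin)
    (hf : f.IsolatedAtOrigin) (hg₀ : g.FixesOrigin) (hg : g.IsolatedAtOrigin)
    {a : Matrix (Fin n) (Fin n) (MvPolynomial (Fin n) K)} (ha : ∀ i, f i = ∑ j, a i j * X j)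
    {φ : f.LocalAlgebra →ₗ[K] K} (hφ : f.IsNormalized φ)
    {ψ : g.LocalAlgebra →ₗ[K] K} (hψ : g.IsNormalized ψ)
    {χ : (f.comp g).LocalAlgebra →ₗ[K] K}
    (hψχ : ∀ b, ψ (toFibre hf₀ g b) =
      χ (localPullback f hg₀ (f.toLocalAlgHom a.det) * b)) :
    ∃ e : f.LocalAlgebra ⊗[K] g.LocalAlgebra ≃ₗ[K] (f.comp g).LocalAlgebra,
      ∀ v w v' w', (f.comp g).bilin χ (e (v ⊗ₜ w)) (e (v' ⊗ₜ w')) =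
        f.bilin φ v v' * g.bilin ψ w w' := by
  have := finite_localAlgebra hf
  have := finite_localAlgebra hg
  exact IsSocleGenerator.exists_tensor_isometry (A := f.LocalAlgebra)
    (B := (f.comp g).LocalAlgebra) (C := g.LocalAlgebra) h2 (isSocleGenerator_det hf₀ hf ha)
    (isClosedFibre hf₀ hf hg₀ hg)
    ((isNormalized_iff hf ha).mp hφ) hψχ (hψ.nondegenerate hg₀ hg)

theorem exists_cls_comp_eq_mul (h2 : (2 : K) ≠ 0) (hf₀ : f.FixesOrigin)
    (hf : f.IsolatedAtOrigin) (hg₀ : g.FixesOrigin) (hg : g.IsolatedAtOrigin) :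
    ∃ (φ : f.LocalAlgebra →ₗ[K] K) (ψ : g.LocalAlgebra →ₗ[K] K)
      (χ : (f.comp g).LocalAlgebra →ₗ[K] K) (hφ : f.IsNormalized φ) (hψ : g.IsNormalized ψ)
      (hχ : (f.comp g).IsNormalized χ),
      GW.cls (bilinSpace (hf₀.comp hg₀) (hf.comp hg) hχ) =
        GW.cls (bilinSpace hf₀ hf hφ) * GW.cls (bilinSpace hg₀ hg hψ) := by
  obtain ⟨a, ha⟩ := hf₀.exists_matrix
  obtain ⟨φ, hφ⟩ := exists_isNormalized hf₀ hf
  obtain ⟨χ, hχ⟩ := exists_isNormalized (hf₀.comp hg₀) (hf.comp hg)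
  -- φ and χ are arbitrary normalized functionals; ψ is forced by χ. This is harmless because the
  -- class for g does not depend on ψ.
  obtain ⟨ψ, hψχ⟩ := exists_fibre_functional hf₀ hf hg₀ hg ha χ
  have hψ := isNormalized_fibre hf₀ hf hg₀ hg ha hχ hψχ
  obtain ⟨e, he⟩ := exists_tensor_isometry h2 hf₀ hf hg₀ hg ha hφ hψ hψχ
  refine ⟨φ, ψ, χ, hφ, hψ, hχ, ?_⟩
  rw [← GW.cls_tensor]
  exact (GW.cls_eq (SymmBilinSpace.tensor_equiv_of (A := bilinSpace hf₀ hf hφ)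
    (B := bilinSpace hg₀ hg hψ) (C := bilinSpace (hf₀.comp hg₀) (hf.comp hg) hχ) e he)).symm

end Comp

end PolyMap

theorem theoremA2 {K : Type*} [Field K] (hK : ringChar K ≠ 2) (n : ℕ) (f g : PolyMap K n)
    (hf₀ : f.FixesOrigin) (hg₀ : g.FixesOrigin)
    (hf : f.IsolatedAtOrigin) (hg : g.IsolatedAtOrigin) :
    (f.comp g).FixesOrigin ∧ (f.comp g).IsolatedAtOrigin ∧
      f.IsEKLDegree f.eklDegree ∧ g.IsEKLDegree g.eklDegree ∧
      (f.comp g).IsEKLDegree (f.comp g).eklDegree ∧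
      (f.comp g).eklDegree = f.eklDegree * g.eklDegree := by
  have h2 : (2 : K) ≠ 0 := Ring.two_ne_zero hK
  obtain ⟨φ, ψ, χ, hφ, hψ, hχ, h⟩ := PolyMap.exists_cls_comp_eq_mul h2 hf₀ hf hg₀ hg
  have h₁ := PolyMap.isEKLDegree_cls h2 hf₀ hf hφ
  have h₂ := PolyMap.isEKLDegree_cls h2 hg₀ hg hψ
  have h₃ := PolyMap.isEKLDegree_cls h2 (hf₀.comp hg₀) (hf.comp hg) hχ
  rw [h₁.eq_eklDegree, h₂.eq_eklDegree, h₃.eq_eklDegree]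
  exact ⟨hf₀.comp hg₀, hf.comp hg, h₁, h₂, h₃, h⟩
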